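/- Let $B=\mathbb{Z}[i,j,k]$ be the quaternion order with $i^2=-1$, $j^2=3$, $ij=-ji=k$. For a commutative ring $R$ let $\mathbf{G}(R)$ be the group of all $x\in \operatorname{GL}_2(B\otimes R)$ of reduced norm $1$; embedding it in $\operatorname{GL}_8(R)$ by left multiplication on $(B\otimes R)^2\cong R^8$ makes $\mathbf{G}$ a linear algebraic group over $\mathbb{Z}$. Put $G=\mathbf{G}(\mathbb{R})$ and $\Gamma=\mathbf{G}(\mathbb{Z})$. Then: 1. $\mathbf{G}$ is semisimple, and the isomorphism $\iota: M_2(B\otimes\mathbb{R})\to M_4(\mathbb{R})$ given on blocks by $$i\mapsto\begin{pmatrix}0&-1\\1&0\end{pmatrix},\quad j\mapsto\begin{pmatrix}\sqrt3&0\\0&-\sqrt3\end{pmatrix},\quad k\mapsto\begin{pmatrix}0&\sqrt3\\\sqrt3&0\end{pmatrix}$$ restricts to an isomorphism of topological groups $G\cong \operatorname{SL}_4(\mathbb{R})$. 2. $\operatorname{rk}_{\mathbb{Q}}(\mathbf{G})=1<\operatorname{rk}_{\mathbb{R}}(\mathbf{G})=3$, where $\operatorname{rk}_K(\mathbf{G})$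 is the largest dimension of a $K$-split $K$-torus contained in $\mathbf{G}$. 3. The torus $\{\operatorname{diag}(t,t^{-1})\}\subset \mathbf{G}$ is a maximal $\mathbb{Q}$-split $\mathbb{Q}$-torus of $\mathbf{G}$. For every maximal $\mathbb{Q}$-split $\mathbb{Q}$-torus $\mathbf{S}$ of $\mathbf{G}$ (in particular for this one), with $S=\mathbf{S}(\mathbb{R})$, there is a point $x\in G/\Gamma$ such that the orbit $Sx$ is compact and, for every compact set $K\subseteq G/\Gamma$, there is $g\in G$ with $gSx\cap K=\emptyset$. -/

import Mathlib

open scoped Quaternion Pointwise MatrixGroups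

noncomputable section

/-! ### Linear algebraic groups, split tori, rank, semisimplicity -/

/-- A linear algebraic group over `k`: a closed subgroup scheme of `GL_n` over `k`, given by its
functor of points. On `R`-points it is a subgroup of `GL_n(R)`, cut out by one family of polynomial
equations with coefficients in `k`, the same for all commutative `k`-algebras `R`. -/
structure AlgGroup (k : Type) [CommRing k] (n : Type) [Fintype n] [DecidableEq n] where
  /-- The group of `R`-points. -/
  points : ∀ (R : Type) [CommRing R] [Algebra k R], Subgroup (GL n R)
  closed : ∃ I : Set (MvPolynomial (n × n) k),
    ∀ (R : Type) [CommRing R] [Algebra k R] (g : GL n R),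
      g ∈ points R ↔ ∀ p ∈ I, MvPolynomial.aeval (fun ij : n × n => g ij.1 ij.2) p = 0

namespace AlgGroup

variable {n : Type} [Fintype n] [DecidableEq n]

/-- `T` is a split torus over `K` of dimension `r`: it is isomorphic over `K` to the `r`-th power
of the multiplicative group, i.e. there are group isomorphisms `(Rˣ)^r ≃ T(R)`, natural in the
commutative `K`-algebra `R`. -/
def IsSplitTorusOfDim {K : Type} [Field K] (T : AlgGroup K n) (r : ℕ) : Prop :=
  ∃ φ : ∀ (R : Type) [CommRing R] [Algebra K R], (Fin r → Rˣ) ≃* T.points R,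
    ∀ (R R' : Type) [CommRing R] [Algebra K R] [CommRing R'] [Algebra K R'] (f : R →ₐ[K] R')
      (t : Fin r → Rˣ),
      Matrix.GeneralLinearGroup.map (f : R →+* R') (φ R t : GL n R) =
        (φ R' (fun i => Units.map (f : R →* R') (t i)) : GL n R')

/-- `T ⊆ G` as algebraic groups over `K`, where `G` is defined over `ℤ`. -/
def IsSubgroupOver (K : Type) [Field K] (G : AlgGroup ℤ n) (T : AlgGroup K n) : Prop :=
  ∀ (R : Type) [CommRing R] [Algebra K R], T.points R ≤ G.points R

/-- The `K`-rank of `G` is `r`: the greatest dimension of a `K`-split `K`-torus contained in `G`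
is `r`. -/
def HasSplitRank (K : Type) [Field K] (G : AlgGroup ℤ n) (r : ℕ) : Prop :=
  IsGreatest {d : ℕ | ∃ T : AlgGroup K n, IsSubgroupOver K G T ∧ T.IsSplitTorusOfDim d} r

/-- `S` is a maximal `K`-split `K`-torus of `G`. -/
def IsMaximalSplitTorus (K : Type) [Field K] (G : AlgGroup ℤ n) (S : AlgGroup K n) : Prop :=
  (IsSubgroupOver K G S ∧ ∃ d, S.IsSplitTorusOfDim d) ∧
    ∀ T : AlgGroup K n, IsSubgroupOver K G T → (∃ d, T.IsSplitTorusOfDim d) →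
      (∀ (R : Type) [CommRing R] [Algebra K R], S.points R ≤ T.points R) →
      ∀ (R : Type) [CommRing R] [Algebra K R], T.points R ≤ S.points R

/-- A set of invertible complex matrices is Zariski closed in `GL_n(ℂ)`. -/
def IsZariskiClosed (Z : Set (GL n ℂ)) : Prop :=
  ∃ I : Set (MvPolynomial (n × n) ℂ),
    ∀ g : GL n ℂ, g ∈ Z ↔ ∀ p ∈ I, MvPolynomial.eval (fun ij : n × n => g ij.1 ij.2) p = 0

/-- A subgroup of `GL_n(ℂ)` is connected in the Zariski topology. -/
def IsZariskiConnected (H : Subgroup (GL n ℂ)) : Prop :=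
  ∀ Z₁ Z₂ : Set (GL n ℂ), IsZariskiClosed Z₁ → IsZariskiClosed Z₂ →
    (H : Set (GL n ℂ)) ⊆ Z₁ ∪ Z₂ → (H : Set (GL n ℂ)) ∩ (Z₁ ∩ Z₂) = ∅ →
    (H : Set (GL n ℂ)) ⊆ Z₁ ∨ (H : Set (GL n ℂ)) ⊆ Z₂

/-- `G` is semisimple (as an algebraic group in characteristic zero): `G(ℂ)` is connected, and its
only Zariski closed connected solvable normal subgroup is trivial. -/
def IsSemisimple (G : AlgGroup ℤ n) : Prop :=
  IsZariskiConnected (G.points ℂ) ∧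
    ∀ N : Subgroup (GL n ℂ), N ≤ G.points ℂ → (∀ g ∈ G.points ℂ, ∀ x ∈ N, g * x * g⁻¹ ∈ N) →
      IsZariskiClosed (N : Set (GL n ℂ)) → IsZariskiConnected N → Group.IsSolvable N → N = ⊥

/-- The arithmetic subgroup `Γ = G(ℤ)` of the real Lie group `G(ℝ)`. -/
def arith (G : AlgGroup ℤ n) : Subgroup (G.points ℝ) :=
  ((G.points ℤ).map (Matrix.GeneralLinearGroup.map (Int.castRingHom ℝ))).subgroupOf (G.points ℝ)

/-- The orbit `S x = {s x : s ∈ S(ℝ)}` of a point `x` of `G(ℝ)/G(ℤ)`. -/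
def torusOrbit (G : AlgGroup ℤ n) (S : AlgGroup ℚ n) (x : G.points ℝ ⧸ G.arith) :
    Set (G.points ℝ ⧸ G.arith) :=
  {y | ∃ s : G.points ℝ, (s : GL n ℝ) ∈ S.points ℝ ∧ y = s • x}

end AlgGroup

/-! ### The group of `2 × 2` quaternion matrices of reduced norm one -/

namespace QuatForm

/-- The order `B = ℤ[i, j, k]`, `i² = -1`, `j² = 3`, `ij = -ji = k`, extended to a commutative
ring `R`: the quaternion algebra `B ⊗ R`. -/
abbrev Quat (R : Type) [CommRing R] : Type := ℍ[R,-1,3]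

/-- The matrices `i`, `j`, `k` in `M₂(S)` attached to a square root `s` of `3` in `S`. -/
def splitBasis (R : Type) {S : Type} [CommRing R] [CommRing S] [Algebra R S] (s : S)
    (hs : s * s = 3) : QuaternionAlgebra.Basis (Matrix (Fin 2) (Fin 2) S) (-1 : R) 0 3 where
  i := !![0, -1; 1, 0]
  j := !![s, 0; 0, -s]
  k := !![0, s; s, 0]
  i_mul_i := by
    ext a b; fin_cases a <;> fin_cases b <;> simp
  j_mul_j := by
    ext a b; fin_cases a <;> fin_cases b <;> simp [hs, Algebra.smul_def, map_ofNat]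
  i_mul_j := by
    ext a b; fin_cases a <;> fin_cases b <;> simp
  j_mul_i := by
    ext a b; fin_cases a <;> fin_cases b <;> simp

/-- The homomorphism `ι : M₂(B ⊗ R) → M₄(S)` attached to a square root `s` of `3` in the
`R`-algebra `S`: each entry is replaced by its `2 × 2` block. -/
def iota (R : Type) {S : Type} [CommRing R] [CommRing S] [Algebra R S] (s : S) (hs : s * s = 3) :
    Matrix (Fin 2) (Fin 2) (Quat R) →ₐ[R] Matrix (Fin 4) (Fin 4) S :=
  ((Matrix.reindexAlgEquiv R S (finProdFinEquiv : Fin 2 × Fin 2 ≃ Fin (2 * 2))).toAlgHom.comp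
    (Matrix.compAlgEquiv (Fin 2) (Fin 2) S R).toAlgHom).comp
      (splitBasis R s hs).liftHom.mapMatrix

lemma omega_sq (R : Type) [CommRing R] :
    (QuadraticAlgebra.omega : QuadraticAlgebra R 3 0) * QuadraticAlgebra.omega = 3 := by
  rw [QuadraticAlgebra.omega_mul_omega_eq_mk,
    ← map_ofNat (algebraMap R (QuadraticAlgebra R 3 0)) 3]
  ext <;> simp

lemma sqrt_three_sq : √(3 : ℝ) * √3 = 3 := Real.mul_self_sqrt (by norm_num)

/-- The reduced norm on `M₂(B ⊗ R)`: the determinant after splitting `B` over `R[√3]`. -/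
def nrd (R : Type) [CommRing R] :
    Matrix (Fin 2) (Fin 2) (Quat R) →* QuadraticAlgebra R 3 0 :=
  Matrix.detMonoidHom.comp
    (iota R (QuadraticAlgebra.omega : QuadraticAlgebra R 3 0) (omega_sq R) :
      Matrix (Fin 2) (Fin 2) (Quat R) →* Matrix (Fin 4) (Fin 4) (QuadraticAlgebra R 3 0))

/-- The matrix of left multiplication by an element of `M₂(B ⊗ R)` on the free `R`-module
`(B ⊗ R)²`, with respect to its basis `1, i, j, k` in each coordinate. -/
def leftMul (R : Type) [CommRing R] :
    Matrix (Fin 2) (Fin 2) (Quat R) →ₐ[R] Matrix (Fin 2 × Fin 4) (Fin 2 × Fin 4) R :=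
  (Matrix.compAlgEquiv (Fin 2) (Fin 4) R R).toAlgHom.comp
    (Algebra.leftMulMatrix (QuaternionAlgebra.basisOneIJK (-1 : R) 0 3)).mapMatrix

/-- Left multiplication as a homomorphism `GL₂(B ⊗ R) → GL₈(R)`. -/
def leftMulUnits (R : Type) [CommRing R] :
    (Matrix (Fin 2) (Fin 2) (Quat R))ˣ →* GL (Fin 2 × Fin 4) R :=
  Units.map (leftMul R : Matrix (Fin 2) (Fin 2) (Quat R) →* _)

/-- The `R`-points: elements of `GL₂(B ⊗ R)` of reduced norm one. -/
def normOne (R : Type) [CommRing R] : Subgroup (GL (Fin 2 × Fin 4) R) :=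
  (Units.map (nrd R)).ker.map (leftMulUnits R)

/-- The homomorphism `t ↦ diag(t, t⁻¹)` from `Rˣ` to `GL₂(B ⊗ R)`. -/
def diagUnits (R : Type) [CommRing R] : Rˣ →* (Matrix (Fin 2) (Fin 2) (Quat R))ˣ where
  toFun t :=
    { val := Matrix.diagonal ![algebraMap R (Quat R) t, algebraMap R (Quat R) ↑t⁻¹]
      inv := Matrix.diagonal ![algebraMap R (Quat R) ↑t⁻¹, algebraMap R (Quat R) t]
      val_inv := by
        rw [Matrix.diagonal_mul_diagonal, ← Matrix.diagonal_one]
        congr 1; funext a; fin_cases a <;> simp [← QuaternionAlgebra.coe_mul]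
      inv_val := by
        rw [Matrix.diagonal_mul_diagonal, ← Matrix.diagonal_one]
        congr 1; funext a; fin_cases a <;> simp [← QuaternionAlgebra.coe_mul] }
  map_one' := by
    ext1
    simp only [Units.val_one, inv_one, map_one]
    rw [← Matrix.diagonal_one]
    congr 1; funext a; fin_cases a <;> simp
  map_mul' s t := by
    ext1
    simp only [Units.val_mul]
    rw [Matrix.diagonal_mul_diagonal]
    congr 1; funext a; fin_cases a <;> simp [mul_comm]

/-- The quaternion matrix whose entries have as coordinates the columns `(q, 0)` of `M`. -/
def extract {R : Type} [CommRing R] (M : Matrix (Fin 2 × Fin 4) (Fin 2 × Fin 4) R) :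
    Matrix (Fin 2) (Fin 2) (Quat R) :=
  Matrix.of fun p q => ⟨M (p, 0) (q, 0), M (p, 1) (q, 0), M (p, 2) (q, 0), M (p, 3) (q, 0)⟩

/-- A ring homomorphism applied to the coordinates of a quaternion. -/
def quatMap {R R' : Type} [CommRing R] [CommRing R'] (f : R →+* R') (q : Quat R) : Quat R' :=
  ⟨f q.re, f q.imI, f q.imJ, f q.imK⟩

lemma extract_map {R R' : Type} [CommRing R] [CommRing R'] (f : R →+* R')
    (M : Matrix (Fin 2 × Fin 4) (Fin 2 × Fin 4) R) :
    extract (M.map f) = (extract M).map (quatMap f) := rfl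

lemma leftMul_apply {R : Type} [CommRing R] (x : Matrix (Fin 2) (Fin 2) (Quat R))
    (p q : Fin 2) (a b : Fin 4) :
    leftMul R x (p, a) (q, b) =
      Algebra.leftMulMatrix (QuaternionAlgebra.basisOneIJK (-1 : R) 0 3) (x p q) a b := rfl

lemma basis_apply {R : Type} [CommRing R] (b : Fin 4) :
    QuaternionAlgebra.basisOneIJK (-1 : R) 0 3 b =
      ⟨Pi.single (M := fun _ => R) b 1 0, Pi.single (M := fun _ => R) b 1 1, Pi.single (M := fun _ => R) b 1 2, Pi.single (M := fun _ => R) b 1 3⟩ := by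
  apply (QuaternionAlgebra.basisOneIJK (-1 : R) 0 3).repr.injective
  rw [Module.Basis.repr_self]
  ext a
  rw [QuaternionAlgebra.coe_basisOneIJK_repr, Finsupp.single_eq_pi_single]
  fin_cases a <;> simp

lemma leftMulMatrix_eq {R : Type} [CommRing R] (q : Quat R) :
    Algebra.leftMulMatrix (QuaternionAlgebra.basisOneIJK (-1 : R) 0 3) q =
      !![q.re, -q.imI, 3 * q.imJ, 3 * q.imK;
         q.imI, q.re, 3 * q.imK, -(3 * q.imJ);
         q.imJ, q.imK, q.re, -q.imI;
         q.imK, -q.imJ, q.imI, q.re] := by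
  ext a b
  rw [Algebra.leftMulMatrix_eq_repr_mul, QuaternionAlgebra.coe_basisOneIJK_repr, basis_apply]
  fin_cases a <;> fin_cases b <;> simp [mul_comm]

lemma extract_leftMul_mul {R : Type} [CommRing R] (x : Matrix (Fin 2) (Fin 2) (Quat R))
    (M : Matrix (Fin 2 × Fin 4) (Fin 2 × Fin 4) R) :
    extract (leftMul R x * M) = x * extract M := by
  ext p q <;>
    simp [extract, Matrix.mul_apply, Fintype.sum_prod_type, leftMul_apply, leftMulMatrix_eq,
      Fin.sum_univ_four] <;> ring

lemma extract_one {R : Type} [CommRing R] :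
    extract (1 : Matrix (Fin 2 × Fin 4) (Fin 2 × Fin 4) R) = 1 := by
  ext p q <;> fin_cases p <;> fin_cases q <;> simp [extract, Matrix.one_apply]

lemma extract_leftMul {R : Type} [CommRing R] (x : Matrix (Fin 2) (Fin 2) (Quat R)) :
    extract (leftMul R x) = x := by
  have h := extract_leftMul_mul x 1
  rwa [mul_one, extract_one, mul_one] at h

lemma leftMul_map {R R' : Type} [CommRing R] [CommRing R'] (f : R →+* R')
    (x : Matrix (Fin 2) (Fin 2) (Quat R)) :
    leftMul R' (x.map (quatMap f)) = (leftMul R x).map f := by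
  ext ⟨p, a⟩ ⟨q, b⟩
  rw [Matrix.map_apply, leftMul_apply, leftMul_apply, leftMulMatrix_eq, leftMulMatrix_eq]
  fin_cases a <;> fin_cases b <;> simp [quatMap, map_ofNat]

/-- A ring homomorphism applied to the coordinates of an element of `R[√3]`. -/
def sqrtMap {R R' : Type} [CommRing R] [CommRing R'] (f : R →+* R') :
    QuadraticAlgebra R 3 0 →+* QuadraticAlgebra R' 3 0 where
  toFun z := ⟨f z.re, f z.im⟩
  map_one' := by ext <;> simp [QuadraticAlgebra.re_one, QuadraticAlgebra.im_one]
  map_mul' z w := by ext <;> simp [map_ofNat]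
  map_zero' := by ext <;> simp
  map_add' z w := by ext <;> simp

lemma iota_apply {R S : Type} [CommRing R] [CommRing S] [Algebra R S] (s : S) (hs : s * s = 3)
    (x : Matrix (Fin 2) (Fin 2) (Quat R)) (p a q b : Fin 2) :
    iota R s hs x ((finProdFinEquiv : Fin 2 × Fin 2 ≃ Fin (2 * 2)) (p, a))
      ((finProdFinEquiv : Fin 2 × Fin 2 ≃ Fin (2 * 2)) (q, b)) =
      (splitBasis R s hs).liftHom (x p q) a b := by
  have h (i : Fin 2 × Fin 2) : finProdFinEquiv.symm (finProdFinEquiv i) = i :=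
    Equiv.symm_apply_apply _ i
  change (splitBasis R s hs).liftHom
    (x (finProdFinEquiv.symm (finProdFinEquiv (p, a))).1
      (finProdFinEquiv.symm (finProdFinEquiv (q, b))).1)
    (finProdFinEquiv.symm (finProdFinEquiv (p, a))).2
    (finProdFinEquiv.symm (finProdFinEquiv (q, b))).2 = _
  rw [h, h]

lemma nrd_apply {R : Type} [CommRing R] (x : Matrix (Fin 2) (Fin 2) (Quat R)) :
    nrd R x =
      (iota R (QuadraticAlgebra.omega : QuadraticAlgebra R 3 0) (omega_sq R) x).det := rfl

lemma nrd_map {R R' : Type} [CommRing R] [CommRing R'] (f : R →+* R')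
    (x : Matrix (Fin 2) (Fin 2) (Quat R)) :
    nrd R' (x.map (quatMap f)) = sqrtMap f (nrd R x) := by
  have h : iota R' (QuadraticAlgebra.omega : QuadraticAlgebra R' 3 0) (omega_sq R')
      (x.map (quatMap f)) =
      (sqrtMap f).mapMatrix
        (iota R (QuadraticAlgebra.omega : QuadraticAlgebra R 3 0) (omega_sq R) x) := by
    refine Matrix.ext fun a' b' => ?_
    obtain ⟨⟨p, a⟩, rfl⟩ := (finProdFinEquiv : Fin 2 × Fin 2 ≃ Fin (2 * 2)).surjective a'
    obtain ⟨⟨q, b⟩, rfl⟩ := (finProdFinEquiv : Fin 2 × Fin 2 ≃ Fin (2 * 2)).surjective b'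
    refine (iota_apply _ _ _ p a q b).trans (Eq.trans ?_
      (congrArg (sqrtMap f) (iota_apply _ (omega_sq R) x p a q b)).symm)
    rw [Matrix.map_apply]
    fin_cases a <;> fin_cases b <;> ext <;>
      simp [QuaternionAlgebra.Basis.liftHom, QuaternionAlgebra.Basis.lift, splitBasis, quatMap,
        sqrtMap, Matrix.algebraMap_matrix_apply, QuadraticAlgebra.re_one, QuadraticAlgebra.im_one]
  rw [nrd_apply, nrd_apply, RingHom.map_det, h]

lemma mem_normOne_iff {R : Type} [CommRing R] (g : GL (Fin 2 × Fin 4) R) :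
    g ∈ normOne R ↔
      leftMul R (extract (g : Matrix (Fin 2 × Fin 4) (Fin 2 × Fin 4) R)) = g ∧
        nrd R (extract (g : Matrix (Fin 2 × Fin 4) (Fin 2 × Fin 4) R)) = 1 := by
  constructor
  · rintro ⟨u, hu, rfl⟩
    have hv : ((leftMulUnits R u : GL (Fin 2 × Fin 4) R) :
        Matrix (Fin 2 × Fin 4) (Fin 2 × Fin 4) R) = leftMul R u := rfl
    rw [hv, extract_leftMul]
    exact ⟨rfl, congrArg Units.val hu⟩
  · rintro ⟨h1, h2⟩
    set x := extract (g : Matrix (Fin 2 × Fin 4) (Fin 2 × Fin 4) R) with hx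
    set y := extract ((g⁻¹ : GL (Fin 2 × Fin 4) R) :
      Matrix (Fin 2 × Fin 4) (Fin 2 × Fin 4) R) with hy
    have hxy : x * y = 1 := by
      rw [hy, ← extract_leftMul_mul, h1, Units.mul_inv, extract_one]
    have hgy : (g : Matrix (Fin 2 × Fin 4) (Fin 2 × Fin 4) R) * leftMul R y = 1 := by
      rw [← h1, ← map_mul, hxy, map_one]
    have hyx : y * x = 1 := by
      have h3 := mul_eq_one_comm.mp hgy
      rw [← h1, ← map_mul] at h3
      rw [← extract_leftMul (y * x), h3, extract_one]
    exact ⟨⟨x, y, hxy, hyx⟩, Units.ext h2, Units.ext h1⟩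

/-- Polynomials in the entries of an `8 × 8` matrix. -/
abbrev Poly (k : Type) [CommRing k] : Type :=
  MvPolynomial ((Fin 2 × Fin 4) × (Fin 2 × Fin 4)) k

/-- The group scheme over `ℤ` whose `R`-points are the elements of `GL₂(B ⊗ R)` of reduced norm
one, embedded in `GL₈` by left multiplication on `(B ⊗ R)²`. -/
def group : AlgGroup ℤ (Fin 2 × Fin 4) where
  points R _ _ := normOne R
  closed := by
    let X : Matrix (Fin 2 × Fin 4) (Fin 2 × Fin 4) (Poly ℤ) := Matrix.of fun i j => MvPolynomial.X (i, j)
    refine ⟨Set.range (fun ij : (Fin 2 × Fin 4) × (Fin 2 × Fin 4) =>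
      leftMul (Poly ℤ) (extract X) ij.1 ij.2 - X ij.1 ij.2) ∪
      {(nrd (Poly ℤ) (extract X)).re - 1, (nrd (Poly ℤ) (extract X)).im}, ?_⟩
    intro R _ _ g
    let f : Poly ℤ →ₐ[ℤ] R :=
      MvPolynomial.aeval (fun ij : (Fin 2 × Fin 4) × (Fin 2 × Fin 4) => g ij.1 ij.2)
    have hX : X.map (f : Poly ℤ →+* R) = (g : Matrix (Fin 2 × Fin 4) (Fin 2 × Fin 4) R) := by
      ext i j
      simp [X, f]
    have h1 : leftMul R (extract (g : Matrix (Fin 2 × Fin 4) (Fin 2 × Fin 4) R)) =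
        (leftMul (Poly ℤ) (extract X)).map (f : Poly ℤ →+* R) := by
      rw [← leftMul_map, ← extract_map, hX]
    have h2 : nrd R (extract (g : Matrix (Fin 2 × Fin 4) (Fin 2 × Fin 4) R)) =
        sqrtMap (f : Poly ℤ →+* R) (nrd (Poly ℤ) (extract X)) := by
      rw [← nrd_map, ← extract_map, hX]
    rw [mem_normOne_iff, h1, h2, QuadraticAlgebra.ext_iff, ← Matrix.ext_iff]
    constructor
    · rintro ⟨ha, hb, hc⟩ p (⟨⟨i, j⟩, rfl⟩ | rfl | rfl)
      · change f _ = 0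
        rw [map_sub, sub_eq_zero]
        exact (ha i j).trans (by rw [← hX]; rfl)
      · change f _ = 0
        rw [map_sub, map_one, sub_eq_zero]
        exact hb.trans QuadraticAlgebra.re_one
      · exact hc.trans QuadraticAlgebra.im_one
    · intro h
      refine ⟨fun i j => ?_, ?_, ?_⟩
      · have h3 : f _ = 0 := h _ (Or.inl ⟨(i, j), rfl⟩)
        rw [map_sub, sub_eq_zero] at h3
        exact h3.trans (by rw [← hX]; rfl)
      · have h3 : f _ = 0 := h _ (Or.inr (Or.inl rfl))
        rw [map_sub, map_one, sub_eq_zero] at h3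
        exact h3.trans QuadraticAlgebra.re_one.symm
      · have h3 : f _ = 0 := h _ (Or.inr (Or.inr rfl))
        exact h3.trans QuadraticAlgebra.im_one.symm

lemma leftMul_diagUnits {R : Type} [CommRing R] (t : Rˣ) :
    ((leftMulUnits R (diagUnits R t) : GL (Fin 2 × Fin 4) R) :
      Matrix (Fin 2 × Fin 4) (Fin 2 × Fin 4) R) =
      Matrix.diagonal fun pa => if pa.1 = 0 then (t : R) else ↑t⁻¹ := by
  ext ⟨p, a⟩ ⟨q, b⟩
  change leftMul R (Matrix.diagonal ![algebraMap R (Quat R) t, algebraMap R (Quat R) ↑t⁻¹])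
    (p, a) (q, b) = _
  rw [leftMul_apply, leftMulMatrix_eq]
  fin_cases p <;> fin_cases q <;> fin_cases a <;> fin_cases b <;> simp

/-- The torus over `ℚ` of all matrices `diag(t, t⁻¹)` in `GL₂(B ⊗ R)`. -/
def torus : AlgGroup ℚ (Fin 2 × Fin 4) where
  points R _ _ := ((leftMulUnits R).comp (diagUnits R)).range
  closed := by
    let X : Fin 2 × Fin 4 → Fin 2 × Fin 4 → Poly ℚ := fun i j => MvPolynomial.X (i, j)
    refine ⟨Set.range (fun ij : (Fin 2 × Fin 4) × (Fin 2 × Fin 4) =>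
      X ij.1 ij.2 - if ij.1 = ij.2 then X (ij.1.1, 0) (ij.1.1, 0) else 0) ∪
      {X (0, 0) (0, 0) * X (1, 0) (1, 0) - 1}, ?_⟩
    intro R _ _ g
    constructor
    · rintro ⟨t, rfl⟩ p (⟨⟨i, j⟩, rfl⟩ | rfl)
      · simp only [MonoidHom.comp_apply, leftMul_diagUnits, X, map_sub, apply_ite, map_zero,
          MvPolynomial.aeval_X, Matrix.diagonal_apply]
        by_cases hij : i = j
        · subst hij; by_cases hp : i.1 = 0 <;> simp [hp]
        · simp [hij]
      · simp [MonoidHom.comp_apply, leftMul_diagUnits, X, Matrix.diagonal_apply]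
    · intro h
      have h1 : g (0, 0) (0, 0) * g (1, 0) (1, 0) = 1 := by
        have := h _ (Or.inr rfl)
        simpa [X, sub_eq_zero] using this
      refine ⟨⟨g (0, 0) (0, 0), g (1, 0) (1, 0), h1, (mul_comm _ _).trans h1⟩, ?_⟩
      ext i j
      have h2 := h _ (Or.inl ⟨(i, j), rfl⟩)
      rw [map_sub, sub_eq_zero] at h2
      simp only [X, apply_ite (MvPolynomial.aeval _), map_zero, MvPolynomial.aeval_X] at h2
      rw [MonoidHom.comp_apply, leftMul_diagUnits, Matrix.diagonal_apply]
      refine Eq.trans ?_ h2.symm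
      obtain ⟨p, a⟩ := i
      by_cases hij : (p, a) = j
      · fin_cases p <;> simp
      · simp [hij]

end QuatForm

end

/-! Write D for B ⊗ ℚ. A square root of 3 splits the quaternion algebra, and once 6 is invertible
the splitting `iota` identifies the group with SL₄ (`normOneEquiv`). This gives the isomorphism over
ℝ. Over ℂ, SL₄ is connected and its solvable normal subgroups are central, hence finite; a finite
connected group is trivial, so the group is semisimple.

For the ranks, the universal point of a split torus, with entries in the group algebra of the
character lattice, decomposes the identity into orthogonal idempotents, one for each weight
(`exists_weights`). These lie in M₂(B ⊗ K), and reduced norm one makes the number of weights exceed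
the dimension (`succ_le_of_card_weights_le`). Over ℝ there are at most four such idempotents, in
M₄(ℝ). Over ℚ there are at most two, because D is a division algebra: a² + b² = 3(c² + d²) has only
the trivial rational solution. Hence the ranks 3 and 1.

A nontrivial idempotent of M₂(D) is conjugate to diag(1, 0), so the real points of all maximal
ℚ-split tori are conjugate in G. They are also conjugate to a torus A (`hypTorus`) that contains the
integral matrix γ = (2 3; 1 2), with eigenvalues 2 ± √3. If S = hAh⁻¹ and x = hΓ, then Sx = hAΓ,
which is compact because A modulo ±γᵏ is compact.

The vector (j, 1) satisfies γ(j, 1) = (j, 1)(2 + j), and A preserves the rational line (j, 1)B,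
although A has no rational eigenvectors in the usual sense. An element a of G scaling this line by a
small μ shrinks a nonzero lattice vector uniformly along aAΓ. As in Mahler's criterion, aAΓ then
misses any given compact set, and ah⁻¹ is the required translation. -/

noncomputable section

open scoped commutatorElement

namespace QuatForm

/-! ### Splitting the quaternion algebra by a square root of 3 -/

section Splitting

variable {R : Type} [CommRing R]

/-- `quatMap` as a ring homomorphism. -/
def quatMapHom {R R' : Type} [CommRing R] [CommRing R'] (f : R →+* R') : Quat R →+* Quat R' where
  toFun := quatMap f
  map_one' := by ext <;> simp [quatMap]
  map_mul' x y := by ext <;> simp [quatMap, map_ofNat]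
  map_zero' := by ext <;> simp [quatMap]
  map_add' x y := by ext <;> simp [quatMap]

lemma liftHom_eq {S : Type} [CommRing S] [Algebra R S] (s : S) (hs : s * s = 3) (q : Quat R) :
    (splitBasis R s hs).liftHom q =
      !![algebraMap R S q.re + s * algebraMap R S q.imJ,
          -algebraMap R S q.imI + s * algebraMap R S q.imK;
        algebraMap R S q.imI + s * algebraMap R S q.imK,
          algebraMap R S q.re - s * algebraMap R S q.imJ] := by
  ext a b
  fin_cases a <;> fin_cases b <;>
    simp [QuaternionAlgebra.Basis.liftHom, QuaternionAlgebra.Basis.lift, splitBasis,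
      Matrix.algebraMap_matrix_apply] <;>
    simp [Algebra.smul_def, mul_comm, sub_eq_add_neg]

/-- The index in `Fin 4` of the `a`-th row of the `p`-th block. -/
abbrev blk (p a : Fin 2) : Fin 4 := (finProdFinEquiv : Fin 2 × Fin 2 ≃ Fin (2 * 2)) (p, a)

lemma matrix_ext_blk {S : Type} {M N : Matrix (Fin 4) (Fin 4) S}
    (h : ∀ p a q b, M (blk p a) (blk q b) = N (blk p a) (blk q b)) : M = N := by
  ext a' b'
  obtain ⟨⟨p, a⟩, rfl⟩ := (finProdFinEquiv : Fin 2 × Fin 2 ≃ Fin (2 * 2)).surjective a'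
  obtain ⟨⟨q, b⟩, rfl⟩ := (finProdFinEquiv : Fin 2 × Fin 2 ≃ Fin (2 * 2)).surjective b'
  exact h p a q b

lemma iota_blk {S : Type} [CommRing S] [Algebra R S] (s : S) (hs : s * s = 3)
    (x : Matrix (Fin 2) (Fin 2) (Quat R)) (p a q b : Fin 2) :
    iota R s hs x (blk p a) (blk q b) = (splitBasis R s hs).liftHom (x p q) a b :=
  iota_apply s hs x p a q b

/-- Naturality of the splitting homomorphism. -/
lemma iota_map {R' S S' : Type} [CommRing R'] [CommRing S] [CommRing S'] [Algebra R S]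
    [Algebra R' S'] (f : R →+* R') (g : S →+* S')
    (hfg : ∀ r, g (algebraMap R S r) = algebraMap R' S' (f r)) (s : S) (hs : s * s = 3)
    (s' : S') (hs' : s' * s' = 3) (h : g s = s') (x : Matrix (Fin 2) (Fin 2) (Quat R)) :
    iota R' s' hs' (x.map (quatMap f)) = (iota R s hs x).map g := by
  refine matrix_ext_blk fun p a q b => ?_
  rw [Matrix.map_apply, iota_blk, iota_blk, liftHom_eq, liftHom_eq, Matrix.map_apply]
  fin_cases a <;> fin_cases b <;> simp [quatMap, h, hfg]

/-- The evaluation `R[√3] → R` at a square root of `3`. -/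
def evalSqrt (s : R) (hs : s * s = 3) : QuadraticAlgebra R 3 0 →+* R where
  toFun z := z.re + z.im * s
  map_one' := by simp [QuadraticAlgebra.re_one, QuadraticAlgebra.im_one]
  map_mul' z w := by
    simp only [QuadraticAlgebra.re_mul, QuadraticAlgebra.im_mul]
    linear_combination (-z.im * w.im) * hs
  map_zero' := by simp
  map_add' z w := by simp; ring

/-- The splitting over R[√3] is universal: specialising √3 to s turns it into the splitting attached
to s. -/
lemma evalSqrt_nrd (s : R) (hs : s * s = 3) (x : Matrix (Fin 2) (Fin 2) (Quat R)) :
    evalSqrt s hs (nrd R x) = (iota R s hs x).det := by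
  rw [nrd_apply, RingHom.map_det]
  have h := iota_map (RingHom.id R) (evalSqrt s hs) (fun r => by
    change (algebraMap R (QuadraticAlgebra R 3 0) r).re +
      (algebraMap R (QuadraticAlgebra R 3 0) r).im * s = r
    simp) QuadraticAlgebra.omega (omega_sq R) s hs
    (by change (QuadraticAlgebra.omega : QuadraticAlgebra R 3 0).re +
          (QuadraticAlgebra.omega : QuadraticAlgebra R 3 0).im * s = s
        simp) x
  have hx : x.map (quatMap (RingHom.id R)) = x := by
    ext p q <;> rfl
  rw [hx] at h
  rw [h]
  rfl

lemma neg_sq_eq {s : R} (hs : s * s = 3) : -s * -s = 3 := by rw [neg_mul_neg, hs]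

/-- The two splittings attached to `s` and `-s` are conjugate by `i`, so have the same
determinant. -/
lemma det_iota_neg (s : R) (hs : s * s = 3) (x : Matrix (Fin 2) (Fin 2) (Quat R)) :
    (iota R (-s) (neg_sq_eq hs) x).det = (iota R s hs x).det := by
  let i : Matrix (Fin 2) (Fin 2) (Quat R) := Matrix.diagonal fun _ => ⟨0, 1, 0, 0⟩
  have hi : i * -i = 1 := by
    rw [← Matrix.diagonal_one, Matrix.diagonal_neg, Matrix.diagonal_mul_diagonal]
    congr 1; funext a
    ext <;> simp
  have key : iota R s hs i * iota R s hs x = iota R (-s) (neg_sq_eq hs) x * iota R s hs i := by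
    rw [← map_mul]
    refine matrix_ext_blk fun p a q b => ?_
    rw [Matrix.mul_apply, ← (finProdFinEquiv : Fin 2 × Fin 2 ≃ Fin (2 * 2)).sum_comp,
      Fintype.sum_prod_type]
    simp only [iota_blk, i, Matrix.diagonal_mul, liftHom_eq]
    fin_cases q <;> fin_cases a <;> fin_cases b <;> simp [add_comm]
  have hd : (iota R s hs i).det * (iota R s hs (-i)).det = 1 := by
    rw [← Matrix.det_mul, ← map_mul, hi, map_one, Matrix.det_one]
  have := congrArg Matrix.det key
  rw [Matrix.det_mul, Matrix.det_mul] at this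
  linear_combination (-(iota R s hs (-i)).det) * this +
    ((iota R s hs x).det - (iota R (-s) (neg_sq_eq hs) x).det) * hd

/-- Over a ring containing a square root of `3` and an inverse of `6`, the reduced norm is one if
and only if the determinant of the image in `M₄(R)` is one. -/
lemma nrd_eq_one_iff (s : R) (hs : s * s = 3) (h : R) (hh : h * 6 = 1)
    (x : Matrix (Fin 2) (Fin 2) (Quat R)) : nrd R x = 1 ↔ (iota R s hs x).det = 1 := by
  constructor
  · intro hx
    rw [← evalSqrt_nrd, hx, map_one]
  · intro hx
    have h1 : (nrd R x).re + (nrd R x).im * s = 1 := (evalSqrt_nrd s hs x).trans hx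
    have h2 : (nrd R x).re + (nrd R x).im * -s = 1 :=
      (evalSqrt_nrd (-s) (neg_sq_eq hs) x).trans ((det_iota_neg s hs x).trans hx)
    -- Subtracting the values at s and -s gives 2 · im · s = 0; multiplying by s gives 6 · im = 0.
    have h3 : (nrd R x).im = 0 := by
      linear_combination (h * s) * (h1 - h2) - (nrd R x).im * hh - 2 * h * (nrd R x).im * hs
    rw [h3] at h1
    ext
    · simpa [QuadraticAlgebra.re_one] using h1
    · simpa [QuadraticAlgebra.im_one] using h3

/-- The inverse of the splitting homomorphism over a ring in which `6` is invertible. -/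
def iotaInv (s h : R) (M : Matrix (Fin 4) (Fin 4) R) : Matrix (Fin 2) (Fin 2) (Quat R) :=
  Matrix.of fun p q =>
    -- With h = 1/6 and s² = 3, the factors 3h and sh are 1/2 and 1/(2s).
    ⟨3 * h * (M (blk p 0) (blk q 0) + M (blk p 1) (blk q 1)),
      3 * h * (M (blk p 1) (blk q 0) - M (blk p 0) (blk q 1)),
      s * h * (M (blk p 0) (blk q 0) - M (blk p 1) (blk q 1)),
      s * h * (M (blk p 1) (blk q 0) + M (blk p 0) (blk q 1))⟩

lemma iota_iotaInv (s : R) (hs : s * s = 3) (h : R) (hh : h * 6 = 1)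
    (M : Matrix (Fin 4) (Fin 4) R) : iota R s hs (iotaInv s h M) = M := by
  refine matrix_ext_blk fun p a q b => ?_
  rw [iota_blk, liftHom_eq]
  fin_cases a <;> fin_cases b <;>
    simp only [iotaInv, Matrix.of_apply, Algebra.algebraMap_self, RingHom.id_apply, Fin.zero_eta,
      Fin.mk_one, Matrix.cons_val', Matrix.cons_val_zero, Matrix.cons_val_one,
      Matrix.cons_val_fin_one]
  · linear_combination (h * (M (blk p 0) (blk q 0) - M (blk p 1) (blk q 1))) * hs +
      M (blk p 0) (blk q 0) * hh
  · linear_combination (h * (M (blk p 1) (blk q 0) + M (blk p 0) (blk q 1))) * hs +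
      M (blk p 0) (blk q 1) * hh
  · linear_combination (h * (M (blk p 1) (blk q 0) + M (blk p 0) (blk q 1))) * hs +
      M (blk p 1) (blk q 0) * hh
  · linear_combination (-h * (M (blk p 0) (blk q 0) - M (blk p 1) (blk q 1))) * hs +
      M (blk p 1) (blk q 1) * hh

lemma iotaInv_iota (s : R) (hs : s * s = 3) (h : R) (hh : h * 6 = 1)
    (x : Matrix (Fin 2) (Fin 2) (Quat R)) : iotaInv s h (iota R s hs x) = x := by
  ext p q <;>
    simp only [iotaInv, Matrix.of_apply, iota_blk, liftHom_eq, Algebra.algebraMap_self,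
      RingHom.id_apply, Matrix.cons_val', Matrix.cons_val_zero, Matrix.cons_val_one,
      Matrix.cons_val_fin_one]
  · linear_combination (x p q).re * hh
  · linear_combination (x p q).imI * hh
  · linear_combination (2 * h * (x p q).imJ) * hs + (x p q).imJ * hh
  · linear_combination (2 * h * (x p q).imK) * hs + (x p q).imK * hh

lemma iota_injective (s : R) (hs : s * s = 3) (h : R) (hh : h * 6 = 1) :
    Function.Injective (iota R s hs) :=
  Function.LeftInverse.injective (g := iotaInv s h) (iotaInv_iota s hs h hh)

lemma iotaInv_mul (s : R) (hs : s * s = 3) (h : R) (hh : h * 6 = 1)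
    (M N : Matrix (Fin 4) (Fin 4) R) :
    iotaInv s h (M * N) = iotaInv s h M * iotaInv s h N :=
  iota_injective s hs h hh (by rw [map_mul]; simp only [iota_iotaInv s hs h hh])

lemma iotaInv_one (s : R) (hs : s * s = 3) (h : R) (hh : h * 6 = 1) :
    iotaInv s h (1 : Matrix (Fin 4) (Fin 4) R) = 1 :=
  iota_injective s hs h hh (by rw [map_one, iota_iotaInv s hs h hh])

/-- On general 8 × 8 matrices `extract` is not multiplicative; it suffices that the left factor is a
left multiplication. -/
lemma extract_mul_of_mem {g₁ g₂ : GL (Fin 2 × Fin 4) R} (h₁ : g₁ ∈ normOne R) :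
    extract ((g₁ * g₂ : GL (Fin 2 × Fin 4) R) : Matrix (Fin 2 × Fin 4) (Fin 2 × Fin 4) R) =
      extract (g₁ : Matrix (Fin 2 × Fin 4) (Fin 2 × Fin 4) R) *
        extract (g₂ : Matrix (Fin 2 × Fin 4) (Fin 2 × Fin 4) R) := by
  rw [← extract_leftMul_mul, ((mem_normOne_iff g₁).1 h₁).1, Units.val_mul]

/-- The element of `GL₂(B ⊗ R)` with image `M ∈ SL₄(R)`. -/
def iotaInvUnit (s : R) (hs : s * s = 3) (h : R) (hh : h * 6 = 1)
    (M : Matrix.SpecialLinearGroup (Fin 4) R) : (Matrix (Fin 2) (Fin 2) (Quat R))ˣ where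
  val := iotaInv s h M
  inv := iotaInv s h (M⁻¹ : Matrix.SpecialLinearGroup (Fin 4) R)
  val_inv := by
    rw [← iotaInv_mul s hs h hh, ← Matrix.SpecialLinearGroup.coe_mul, mul_inv_cancel,
      Matrix.SpecialLinearGroup.coe_one, iotaInv_one s hs h hh]
  inv_val := by
    rw [← iotaInv_mul s hs h hh, ← Matrix.SpecialLinearGroup.coe_mul, inv_mul_cancel,
      Matrix.SpecialLinearGroup.coe_one, iotaInv_one s hs h hh]

lemma leftMulUnits_mem_normOne_iff (u : (Matrix (Fin 2) (Fin 2) (Quat R))ˣ) :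
    leftMulUnits R u ∈ normOne R ↔ nrd R u = 1 := by
  rw [mem_normOne_iff]
  change leftMul R (extract (leftMul R u)) = leftMul R u ∧ nrd R (extract (leftMul R u)) = 1 ↔ _
  rw [extract_leftMul]
  exact ⟨fun h => h.2, fun h => ⟨rfl, h⟩⟩

/-- The isomorphism of `normOne R` with `SL₄(R)` attached to a square root of `3`. -/
def normOneEquiv (s : R) (hs : s * s = 3) (h : R) (hh : h * 6 = 1) :
    normOne R ≃* Matrix.SpecialLinearGroup (Fin 4) R where
  toFun g := ⟨iota R s hs (extract (g : GL (Fin 2 × Fin 4) R)),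
    (nrd_eq_one_iff s hs h hh _).1 ((mem_normOne_iff _).1 g.2).2⟩
  invFun M := ⟨leftMulUnits R (iotaInvUnit s hs h hh M), by
    rw [leftMulUnits_mem_normOne_iff, nrd_eq_one_iff s hs h hh]
    exact (congrArg Matrix.det (iota_iotaInv s hs h hh _)).trans M.2⟩
  left_inv g := by
    apply Subtype.ext
    apply Units.ext
    change leftMul R (iotaInv s h (iota R s hs (extract (g : GL (Fin 2 × Fin 4) R)))) = _
    rw [iotaInv_iota s hs h hh, ((mem_normOne_iff _).1 g.2).1]
  right_inv M := by
    apply Subtype.ext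
    change iota R s hs (extract (leftMul R (iotaInv s h M))) = _
    rw [extract_leftMul, iota_iotaInv s hs h hh]
  map_mul' g₁ g₂ := by
    apply Subtype.ext
    change iota R s hs (extract ((g₁ * g₂ : GL (Fin 2 × Fin 4) R) :
      Matrix (Fin 2 × Fin 4) (Fin 2 × Fin 4) R)) = _
    rw [extract_mul_of_mem g₁.2, map_mul]
    rfl

variable [TopologicalSpace R] [IsTopologicalRing R]

lemma continuous_iota_extract (s : R) (hs : s * s = 3) :
    Continuous fun M : Matrix (Fin 2 × Fin 4) (Fin 2 × Fin 4) R => iota R s hs (extract M) := by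
  refine continuous_matrix fun a' b' => ?_
  obtain ⟨⟨p, a⟩, rfl⟩ := (finProdFinEquiv : Fin 2 × Fin 2 ≃ Fin (2 * 2)).surjective a'
  obtain ⟨⟨q, b⟩, rfl⟩ := (finProdFinEquiv : Fin 2 × Fin 2 ≃ Fin (2 * 2)).surjective b'
  have hc (i j : Fin 2 × Fin 4) :
      Continuous fun M : Matrix (Fin 2 × Fin 4) (Fin 2 × Fin 4) R => M i j :=
    continuous_id.matrix_elem i j
  simp only [iota_apply, liftHom_eq, extract, Matrix.of_apply, Algebra.algebraMap_self,
    RingHom.id_apply]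
  fin_cases a <;> fin_cases b <;> simp <;> fun_prop

lemma continuous_leftMul_iotaInv (s h : R) :
    Continuous fun M : Matrix (Fin 4) (Fin 4) R => leftMul R (iotaInv s h M) := by
  refine continuous_matrix fun i j => ?_
  obtain ⟨p, a⟩ := i
  obtain ⟨q, b⟩ := j
  have hc (i j : Fin 4) : Continuous fun M : Matrix (Fin 4) (Fin 4) R => M i j :=
    continuous_id.matrix_elem i j
  simp only [leftMul_apply, leftMulMatrix_eq, iotaInv, Matrix.of_apply]
  fin_cases a <;> fin_cases b <;> simp <;> fun_prop

/-- The isomorphism of topological groups of `normOne R` with `SL₄(R)`. -/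
def normOneContEquiv (s : R) (hs : s * s = 3) (h : R) (hh : h * 6 = 1) :
    normOne R ≃ₜ* Matrix.SpecialLinearGroup (Fin 4) R where
  toMulEquiv := normOneEquiv s hs h hh
  continuous_toFun := by
    refine Continuous.subtype_mk ?_ _
    exact (continuous_iota_extract s hs).comp (Units.continuous_val.comp continuous_subtype_val)
  continuous_invFun := by
    refine Continuous.subtype_mk ?_ _
    refine Units.continuous_iff.2 ⟨?_, ?_⟩
    · exact (continuous_leftMul_iotaInv s h).comp continuous_subtype_val
    · exact (continuous_leftMul_iotaInv s h).comp (continuous_subtype_val.comp continuous_inv)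

end Splitting

end QuatForm

/-! ### Solvable normal subgroups of SLₙ(ℂ), and connectedness of SL₄(ℂ) -/

section SpecialLinear

/-- In the sum of the two relations the terms of odd degree in E cancel, so X commutes with 2X -
2EXE. In the application 1 + E and 1 - E are inverse transvections. -/
lemma mul_comm_of_conj_add_conj {A : Type} [Ring A] [Module ℂ A] {X E : A}
    (h₁ : X * ((1 + E) * X * (1 + -E)) = (1 + E) * X * (1 + -E) * X)
    (h₂ : X * ((1 + -E) * X * (1 + E)) = (1 + -E) * X * (1 + E) * X) :
    X * (E * X * E) = (E * X * E) * X := by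
  have h3 : X * ((1 + E) * X * (1 + -E)) + X * ((1 + -E) * X * (1 + E)) =
      X * X + X * X - (X * (E * X * E) + X * (E * X * E)) := by noncomm_ring
  have h4 : (1 + E) * X * (1 + -E) * X + (1 + -E) * X * (1 + E) * X =
      X * X + X * X - ((E * X * E) * X + (E * X * E) * X) := by noncomm_ring
  rw [h₁, h₂, h4, sub_right_inj, ← two_smul ℂ, ← two_smul ℂ (X * (E * X * E))] at h3
  exact (smul_right_injective _ (two_ne_zero : (2 : ℂ) ≠ 0) h3).symm

variable {n : Type} [Fintype n] [DecidableEq n]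

open Matrix in
/-- A matrix in `SL_n(ℂ)` whose commutators with all its conjugates by transvections are central is
diagonal. -/
lemma apply_eq_zero_of_commutator_mem_center {x : Matrix.SpecialLinearGroup n ℂ}
    {i j : n} (hij : i ≠ j)
    (hx : ∀ u : Matrix.SpecialLinearGroup n ℂ,
      ⁅x, u * x * u⁻¹⁆ ∈ Subgroup.center (Matrix.SpecialLinearGroup n ℂ)) : x j i = 0 := by
  let u : ℂ → Matrix.SpecialLinearGroup n ℂ := fun t => Matrix.SpecialLinearGroup.transvection hij t
  have hu : Continuous u := by
    refine Continuous.subtype_mk ?_ _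
    refine continuous_matrix fun a b => ?_
    simp only [Matrix.transvection, Matrix.add_apply, Matrix.single_apply]
    split_ifs <;> fun_prop
  -- The commutator is a scalar matrix of determinant one, so f(t) is this scalar, an n-th root of
  -- unity. It depends continuously on t and is 1 at t = 0, hence is always 1: x commutes with its
  -- conjugates by transvections.
  let f : ℂ → ℂ := fun t => (⁅x, u t * x * (u t)⁻¹⁆ : Matrix.SpecialLinearGroup n ℂ) i i
  have hf : Continuous f := by
    have : Continuous fun t => (⁅x, u t * x * (u t)⁻¹⁆ : Matrix.SpecialLinearGroup n ℂ) := by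
      simp only [commutatorElement_def]
      fun_prop
    exact (continuous_subtype_val.comp this).matrix_elem i i
  have hT : ({z : ℂ | z ^ Fintype.card n = 1}).Finite := by
    have hn : 0 < Fintype.card n := Fintype.card_pos_iff.2 ⟨i⟩
    refine (Polynomial.nthRoots (Fintype.card n) (1 : ℂ)).toFinset.finite_toSet.subset ?_
    intro z hz
    simpa [Polynomial.mem_nthRoots hn] using hz
  have hmaps : Set.MapsTo f Set.univ {z : ℂ | z ^ Fintype.card n = 1} := by
    intro t _
    obtain ⟨r, hr, h⟩ := Matrix.SpecialLinearGroup.mem_center_iff.1 (hx (u t))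
    have : f t = r := by simp only [f]; rw [← h]; simp
    simpa [this] using hr
  have hconst : ∀ t, f t = 1 := by
    intro t
    have h0 : f 0 = 1 := by
      have : u 0 = 1 := Matrix.SpecialLinearGroup.transvection_coeff_zero hij
      simp [f, this]
    have := isPreconnected_univ.constant_of_mapsTo (hT.isDiscrete) hf.continuousOn hmaps
      (Set.mem_univ t) (Set.mem_univ 0)
    rw [this, h0]
  have hcomm : ∀ t, x * (u t * x * (u t)⁻¹) = (u t * x * (u t)⁻¹) * x := by
    intro t
    obtain ⟨r, hr, h⟩ := Matrix.SpecialLinearGroup.mem_center_iff.1 (hx (u t))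
    have h1 : r = 1 := by
      rw [← hconst t]; simp only [f]; rw [← h]; simp
    have h2 : (⁅x, u t * x * (u t)⁻¹⁆ : Matrix.SpecialLinearGroup n ℂ) = 1 := by
      apply Subtype.ext
      rw [← h, h1]; simp
    exact commutatorElement_eq_one_iff_mul_comm.1 h2
  have huinv : ∀ t, (u t)⁻¹ = u (-t) := by
    intro t
    rw [inv_eq_iff_mul_eq_one]
    apply Subtype.ext
    refine (Matrix.transvection_mul_transvection_same i j hij t (-t)).trans ?_
    simp
  have h1 := congrArg Subtype.val (hcomm 1)
  have h2 := congrArg Subtype.val (hcomm (-1))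
  set X : Matrix n n ℂ := x.1 with hX
  set E : Matrix n n ℂ := Matrix.single i j 1 with hE
  have hv : ∀ t, (u t).1 = 1 + t • E := by
    intro t
    simp [u, Matrix.SpecialLinearGroup.transvection_coe, hE]
  simp only [Matrix.SpecialLinearGroup.coe_mul, huinv, hv] at h1 h2
  simp only [one_smul, neg_smul, neg_neg] at h1 h2
  have hEX := mul_comm_of_conj_add_conj h1 h2
  have hEXE : E * X * E = Matrix.single i j (X j i) := by
    rw [hE]
    ext a b
    simp [Matrix.single_mul_mul_single]
  rw [hEXE] at hEX
  -- Since EXE = X_ji E, the (j, j) entry of this commutation relation is X_ji² = 0.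
  have := congrFun (congrFun hEX j) j
  rw [Matrix.mul_single_apply_same, Matrix.single_mul_apply_of_ne _ _ _ _ _ hij.symm] at this
  exact mul_self_eq_zero.1 this

open Matrix in
/-- If the commutator of a normal subgroup of `SL_n(ℂ)` is central, so is the subgroup. -/
lemma le_center_of_commutator_le_center {H : Subgroup (Matrix.SpecialLinearGroup n ℂ)} (hH : H.Normal)
    (h : ⁅H, H⁆ ≤ Subgroup.center (Matrix.SpecialLinearGroup n ℂ)) :
    H ≤ Subgroup.center (Matrix.SpecialLinearGroup n ℂ) := by
  have hoff : ∀ x ∈ H, ∀ i j, i ≠ j → x j i = 0 := fun x hx i j hij =>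
    apply_eq_zero_of_commutator_mem_center hij fun u =>
      h (Subgroup.commutator_mem_commutator hx (hH.conj_mem x hx u))
  intro x hx
  have hdiag : ∀ i j, i ≠ j → x i i = x j j := by
    intro i j hij
    -- For x diagonal, the (i, j) entry of its conjugate by a transvection is x_jj - x_ii, and the
    -- conjugate is again diagonal.
    have h1 := hoff _ (hH.conj_mem x hx (Matrix.SpecialLinearGroup.transvection hij 1)) j i hij.symm
    have huinv : (Matrix.SpecialLinearGroup.transvection hij (1 : ℂ))⁻¹ =
        Matrix.SpecialLinearGroup.transvection hij (-1) := by
      rw [inv_eq_iff_mul_eq_one]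
      apply Subtype.ext
      refine (Matrix.transvection_mul_transvection_same i j hij (1 : ℂ) (-1)).trans ?_
      simp
    rw [huinv] at h1
    change ((Matrix.transvection i j (1 : ℂ) * x.1 * Matrix.transvection i j (-1) :
      Matrix n n ℂ) i j) = 0 at h1
    rw [Matrix.mul_transvection_apply_same, Matrix.transvection_mul_apply_same,
      Matrix.transvection_mul_apply_same] at h1
    have h2 : x.1 i j = 0 := hoff x hx j i hij.symm
    have h3 : x.1 j i = 0 := hoff x hx i j hij
    rw [h2, h3] at h1
    have h4 : x.1 i i = x.1 j j := by linear_combination -h1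
    exact h4
  rw [Subgroup.mem_center_iff]
  intro y
  apply Subtype.ext
  have hx' : ∀ k, x.1 = Matrix.diagonal fun _ => x.1 k k := by
    intro k
    ext a b
    by_cases hab : a = b
    · subst hab
      rw [Matrix.diagonal_apply_eq]
      by_cases hak : a = k
      · rw [hak]
      · exact hdiag a k hak
    · rw [Matrix.diagonal_apply_ne _ hab]
      exact hoff x hx b a (Ne.symm hab)
  ext a b
  change (y.1 * x.1) a b = (x.1 * y.1) a b
  rw [hx' a, Matrix.mul_diagonal, Matrix.diagonal_mul, mul_comm]

open Matrix in
/-- Solvable normal subgroups of `SL_n(ℂ)` are central. -/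
lemma le_center_of_isSolvable {H : Subgroup (Matrix.SpecialLinearGroup n ℂ)} (hH : H.Normal)
    (hs : Group.IsSolvable H) : H ≤ Subgroup.center (Matrix.SpecialLinearGroup n ℂ) := by
  obtain ⟨m, hm⟩ := hs.solvable
  let D : ℕ → Subgroup (Matrix.SpecialLinearGroup n ℂ) := fun k => (derivedSeries H k).map H.subtype
  have hsucc : ∀ k, D (k + 1) = ⁅D k, D k⁆ := fun k => by
    simp only [D]
    rw [derivedSeries_succ, Subgroup.map_commutator]
  have h0 : D 0 = H := by
    simp only [D]
    rw [derivedSeries_zero, ← MonoidHom.range_eq_map, Subgroup.range_subtype]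
  have hnormal : ∀ k, (D k).Normal := by
    intro k
    induction k with
    | zero => rwa [h0]
    | succ k ih => rw [hsucc]; exact Subgroup.commutator_normal _ _
  -- Centrality climbs back up the derived series, from its trivial term to H itself.
  have hstep : ∀ k, D k ≤ Subgroup.center _ → D 0 ≤ Subgroup.center _ := by
    intro k
    induction k with
    | zero => exact id
    | succ k ih =>
      intro hk
      exact ih (le_center_of_commutator_le_center (hnormal k) (by rwa [hsucc] at hk))
  rw [← h0]
  refine hstep m ?_
  simp [D, hm]

open Matrix in
lemma finite_center_specialLinearGroup [Nonempty n] :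
    (Subgroup.center (Matrix.SpecialLinearGroup n ℂ) : Set (Matrix.SpecialLinearGroup n ℂ)).Finite := by
  have hT : ({z : ℂ | z ^ Fintype.card n = 1}).Finite := by
    have hn : 0 < Fintype.card n := Fintype.card_pos
    refine (Polynomial.nthRoots (Fintype.card n) (1 : ℂ)).toFinset.finite_toSet.subset ?_
    intro z hz
    simpa [Polynomial.mem_nthRoots hn] using hz
  refine Set.Finite.of_finite_image ((hT.image (scalar n)).subset ?_)
    (Subtype.val_injective.injOn (s := _))
  rintro _ ⟨x, hx, rfl⟩
  obtain ⟨r, hr, h⟩ := Matrix.SpecialLinearGroup.mem_center_iff.1 hx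
  exact ⟨r, hr, h⟩

open Matrix in
/-- `SL₄(ℂ)` is connected. -/
lemma isPreconnected_univ_specialLinearGroup :
    IsPreconnected (Set.univ : Set (Matrix.SpecialLinearGroup (Fin 4) ℂ)) := by
  let C := Subgroup.connectedComponentOfOne (Matrix.SpecialLinearGroup (Fin 4) ℂ)
  suffices h : ∀ x, x ∈ C by
    have : connectedComponent (1 : Matrix.SpecialLinearGroup (Fin 4) ℂ) = Set.univ :=
      Set.eq_univ_of_forall h
    rw [← this]
    exact isPreconnected_connectedComponent
  -- A connected family passing through 1 lies in the identity component.
  have hcurve : ∀ {X : Type} [TopologicalSpace X] [PreconnectedSpace X]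
      (F : X → Matrix.SpecialLinearGroup (Fin 4) ℂ), Continuous F → ∀ x₀, F x₀ = 1 → ∀ x, F x ∈ C := by
    intro X _ _ F hF x₀ h0 x
    have h1 := (isPreconnected_range hF).subset_connectedComponent (x := 1) ⟨x₀, h0⟩
    exact h1 ⟨x, rfl⟩
  have htrans : ∀ (i j : Fin 4) (hij : i ≠ j) (t : ℂ), Matrix.SpecialLinearGroup.transvection hij t ∈ C := by
    intro i j hij t
    refine hcurve (fun t => Matrix.SpecialLinearGroup.transvection hij t) ?_ 0 (Matrix.SpecialLinearGroup.transvection_coeff_zero hij) t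
    refine Continuous.subtype_mk ?_ _
    refine continuous_matrix fun a b => ?_
    simp only [Matrix.transvection, Matrix.add_apply, Matrix.single_apply]
    split_ifs <;> fun_prop
  let T : TransvectionStruct (Fin 4) ℂ → Matrix.SpecialLinearGroup (Fin 4) ℂ := fun t =>
    ⟨t.toMatrix, t.det⟩
  have hlist : ∀ L : List (TransvectionStruct (Fin 4) ℂ), (L.map T).prod ∈ C := by
    intro L
    refine Subgroup.list_prod_mem _ fun x hx => ?_
    obtain ⟨t, _, rfl⟩ := List.mem_map.1 hx
    exact htrans t.i t.j t.hij t.c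
  have hval : ∀ L : List (TransvectionStruct (Fin 4) ℂ),
      (L.map T).prod.1 = (L.map TransvectionStruct.toMatrix).prod := by
    intro L
    induction L with
    | nil => rfl
    | cons t L ih => simp only [List.map_cons, List.prod_cons, Matrix.SpecialLinearGroup.coe_mul, ih]; rfl
  intro x
  -- Gaussian elimination leaves a diagonal matrix between products of transvections.
  obtain ⟨L, L', D, h⟩ := Pivot.exists_list_transvec_mul_diagonal_mul_list_transvec x.1
  have hD : D 0 * D 1 * D 2 * D 3 = 1 := by
    have := congrArg Matrix.det h
    rw [det_mul, det_mul, TransvectionStruct.det_toMatrix_prod,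
      TransvectionStruct.det_toMatrix_prod, det_diagonal, x.2, Fin.prod_univ_four] at this
    simpa using this.symm
  -- Logarithms of the first three entries parametrise the diagonal matrices of determinant one by
  -- the connected space ℂ³.
  let F : (Fin 3 → ℂ) → Matrix.SpecialLinearGroup (Fin 4) ℂ := fun w =>
    ⟨diagonal ![Complex.exp (w 0), Complex.exp (w 1), Complex.exp (w 2),
      Complex.exp (-(w 0 + w 1 + w 2))], by
      rw [det_diagonal, Fin.prod_univ_four]
      simp [← Complex.exp_add]⟩
  have hF : Continuous F := by
    refine Continuous.subtype_mk ?_ _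
    refine Continuous.matrix_diagonal (continuous_pi fun a => ?_)
    fin_cases a <;> simp <;> fun_prop
  have hF0 : F 0 = 1 := by
    apply Subtype.ext
    change diagonal _ = 1
    rw [← diagonal_one]
    congr 1; funext a; fin_cases a <;> simp
  have hne : D 0 ≠ 0 ∧ D 1 ≠ 0 ∧ D 2 ≠ 0 := by
    refine ⟨?_, ?_, ?_⟩ <;> intro h0 <;> simp [h0] at hD
  have hFD : (F ![Complex.log (D 0), Complex.log (D 1), Complex.log (D 2)]).1 = diagonal D := by
    change diagonal _ = _
    congr 1; funext a
    fin_cases a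
    · simp [Complex.exp_log hne.1]
    · simp [Complex.exp_log hne.2.1]
    · simp [Complex.exp_log hne.2.2]
    · simp only [Matrix.cons_val_zero, Matrix.cons_val_one, Matrix.cons_val, Fin.reduceFinMk]
      rw [Complex.exp_neg, Complex.exp_add, Complex.exp_add, Complex.exp_log hne.1,
        Complex.exp_log hne.2.1, Complex.exp_log hne.2.2]
      exact (eq_inv_of_mul_eq_one_right hD).symm
  have hx : x = (L.map T).prod * F ![Complex.log (D 0), Complex.log (D 1), Complex.log (D 2)] *
      (L'.map T).prod := by
    apply Subtype.ext
    rw [Matrix.SpecialLinearGroup.coe_mul, Matrix.SpecialLinearGroup.coe_mul, hFD, hval, hval]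
    exact h
  rw [hx]
  exact C.mul_mem (C.mul_mem (hlist L) (hcurve F hF 0 hF0 _)) (hlist L')

end SpecialLinear

/-! ### Zariski connectedness and finite groups -/

namespace AlgGroup

variable {n : Type} [Fintype n] [DecidableEq n]

lemma IsZariskiClosed.isClosed {Z : Set (GL n ℂ)} (hZ : IsZariskiClosed Z) : IsClosed Z := by
  obtain ⟨I, hI⟩ := hZ
  have : Z = ⋂ p ∈ I, {g : GL n ℂ |
      MvPolynomial.eval (fun ij : n × n => g ij.1 ij.2) p = 0} := by
    ext g; simp [hI]
  rw [this]
  refine isClosed_biInter fun p _ => isClosed_eq ?_ continuous_const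
  refine (MvPolynomial.continuous_eval p).comp (continuous_pi fun ij => ?_)
  exact Units.continuous_val.matrix_elem ij.1 ij.2

/-- A subgroup which is connected in the Euclidean topology is connected in the Zariski
topology. -/
lemma isZariskiConnected_of_isPreconnected {H : Subgroup (GL n ℂ)}
    (hH : IsPreconnected (H : Set (GL n ℂ))) : IsZariskiConnected H := by
  intro Z₁ Z₂ h₁ h₂ hsub hdisj
  exact isPreconnected_iff_subset_of_disjoint_closed.1 hH Z₁ Z₂ h₁.isClosed h₂.isClosed hsub hdisj

lemma isZariskiClosed_singleton (g : GL n ℂ) : IsZariskiClosed {g} := by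
  refine ⟨Set.range fun ij : n × n => MvPolynomial.X ij - MvPolynomial.C (g ij.1 ij.2),
    fun x => ⟨?_, fun h => ?_⟩⟩
  · rintro rfl _ ⟨ij, rfl⟩
    simp
  · apply Units.ext
    ext i j
    simpa [sub_eq_zero] using h _ ⟨(i, j), rfl⟩

lemma IsZariskiClosed.union {Z₁ Z₂ : Set (GL n ℂ)} (h₁ : IsZariskiClosed Z₁)
    (h₂ : IsZariskiClosed Z₂) : IsZariskiClosed (Z₁ ∪ Z₂) := by
  obtain ⟨I₁, hI₁⟩ := h₁
  obtain ⟨I₂, hI₂⟩ := h₂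
  refine ⟨Set.image2 (· * ·) I₁ I₂, fun g => ⟨?_, fun h => ?_⟩⟩
  · rintro (hg | hg) _ ⟨p, hp, q, hq, rfl⟩
    · simp [(hI₁ g).1 hg p hp]
    · simp [(hI₂ g).1 hg q hq]
  · by_contra hg
    rw [Set.mem_union, not_or, hI₁, hI₂] at hg
    push Not at hg
    obtain ⟨⟨p, hp, hp0⟩, q, hq, hq0⟩ := hg
    have := h _ ⟨p, hp, q, hq, rfl⟩
    rw [map_mul, mul_eq_zero] at this
    exact this.elim hp0 hq0

lemma isZariskiClosed_of_finite {Z : Set (GL n ℂ)} (hZ : Z.Finite) : IsZariskiClosed Z := by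
  induction Z, hZ using Set.Finite.induction_on with
  | empty => exact ⟨{1}, by simp⟩
  | insert _ _ ih => exact (isZariskiClosed_singleton _).union ih

/-- A finite Zariski connected group is trivial. -/
lemma IsZariskiConnected.eq_bot {H : Subgroup (GL n ℂ)} (hH : IsZariskiConnected H)
    (hfin : (H : Set (GL n ℂ)).Finite) : H = ⊥ := by
  rcases hH {1} ((H : Set (GL n ℂ)) \ {1}) (isZariskiClosed_singleton 1)
    (isZariskiClosed_of_finite hfin.sdiff) (by rw [Set.union_sdiff_self]; exact
      Set.subset_union_right) (by simp) with h | h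
  · exact (Subgroup.eq_bot_iff_forall H).2 fun x hx => h hx
  · exact absurd rfl (h H.one_mem).2

end AlgGroup

/-! ### Semisimplicity -/

namespace QuatForm

/-- `G` is semisimple. -/
lemma isSemisimple_group : group.IsSemisimple := by
  have hs : ((√3 : ℝ) : ℂ) * ((√3 : ℝ) : ℂ) = 3 := by
    rw [← Complex.ofReal_mul, sqrt_three_sq]; norm_num
  let e := normOneContEquiv (R := ℂ) _ hs (1 / 6) (by norm_num)
  refine ⟨AlgGroup.isZariskiConnected_of_isPreconnected ?_, ?_⟩
  · have h1 : (normOne ℂ : Set (GL (Fin 2 × Fin 4) ℂ)) =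
        (fun M => ((e.symm M : normOne ℂ) : GL (Fin 2 × Fin 4) ℂ)) '' Set.univ := by
      ext g
      refine ⟨fun hg => ⟨e ⟨g, hg⟩, trivial, ?_⟩, ?_⟩
      · simp
      · rintro ⟨M, _, rfl⟩
        exact (e.symm M).2
    change IsPreconnected (normOne ℂ : Set (GL (Fin 2 × Fin 4) ℂ))
    rw [h1]
    exact isPreconnected_univ_specialLinearGroup.image _
      (continuous_subtype_val.comp e.symm.continuous).continuousOn
  · intro N hN hnorm _ hconn hsolv
    refine hconn.eq_bot ?_
    -- The image of N in SL₄(ℂ) is normal and solvable, so it lies in the finite centre; thus N is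
    -- finite.
    let N' : Subgroup (Matrix.SpecialLinearGroup (Fin 4) ℂ) :=
      (N.subgroupOf (normOne ℂ)).map (e : normOne ℂ →* Matrix.SpecialLinearGroup (Fin 4) ℂ)
    have hN'n : N'.Normal := by
      refine Subgroup.Normal.map ⟨fun x hx g => ?_⟩ _ e.surjective
      exact hnorm g.1 g.2 x.1 hx
    have hN's : Group.IsSolvable N' := by
      let e' : N.subgroupOf (normOne ℂ) ≃* N := Subgroup.subgroupOfEquivOfLe hN
      have : Group.IsSolvable (N.subgroupOf (normOne ℂ)) :=
        Group.isSolvable_of_isSolvable_injective (f := e'.toMonoidHom) e'.injective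
      exact Group.isSolvable_of_surjective
        (f := (e : normOne ℂ →* Matrix.SpecialLinearGroup (Fin 4) ℂ).subgroupMap
          (N.subgroupOf (normOne ℂ))) (MonoidHom.subgroupMap_surjective _ _)
    have hfin : (N' : Set (Matrix.SpecialLinearGroup (Fin 4) ℂ)).Finite :=
      finite_center_specialLinearGroup.subset (le_center_of_isSolvable hN'n hN's)
    refine (hfin.image fun M => ((e.symm M : normOne ℂ) : GL (Fin 2 × Fin 4) ℂ)).subset ?_
    intro g hg
    exact ⟨e ⟨g, hN hg⟩, ⟨⟨g, hN hg⟩, hg, rfl⟩, by simp⟩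

end QuatForm

/-! ### Weight decomposition of split tori -/

namespace AlgGroup

section Weights

variable {n : Type} [Fintype n] [DecidableEq n]

/-- The value at `t` of the character `χ` of the `r`-dimensional split torus. -/
def charVal {r : ℕ} {R : Type} [CommRing R] (t : Fin r → Rˣ) (χ : Fin r → ℤ) : Rˣ :=
  ∏ i, t i ^ χ i

lemma charVal_add {r : ℕ} {R : Type} [CommRing R] (t : Fin r → Rˣ) (χ ψ : Fin r → ℤ) :
    charVal t (χ + ψ) = charVal t χ * charVal t ψ := by
  simp [charVal, zpow_add, Finset.prod_mul_distrib]

lemma charVal_mul {r : ℕ} {R : Type} [CommRing R] (t u : Fin r → Rˣ) (χ : Fin r → ℤ) :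
    charVal (t * u) χ = charVal t χ * charVal u χ := by
  simp [charVal, mul_zpow, Finset.prod_mul_distrib]

lemma charVal_single {r : ℕ} {R : Type} [CommRing R] (t : Fin r → Rˣ) (i : Fin r) :
    charVal t (Pi.single i 1) = t i := by
  rw [charVal, Finset.prod_eq_single i]
  · simp
  · intro j _ hj; simp [hj]
  · simp

/-- The algebra homomorphism from the group algebra of the character lattice given by a point of
the torus. -/
def charHom {r : ℕ} (K : Type) [Field K] {R : Type} [CommRing R] [Algebra K R] (t : Fin r → Rˣ) :
    AddMonoidAlgebra K (Fin r → ℤ) →ₐ[K] R :=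
  AddMonoidAlgebra.lift K R (Fin r → ℤ)
    { toFun := fun χ => (charVal t χ.toAdd : R)
      map_one' := by simp [charVal]
      map_mul' := fun χ ψ => by simp [toAdd_mul, charVal_add] }

/-- The point of the torus with coordinates `e i` in the group algebra of a lattice `M`. -/
def latticePoint {r : ℕ} (K : Type) [Field K] {M : Type} [AddCommGroup M] (e : Fin r → M) :
    Fin r → (AddMonoidAlgebra K M)ˣ := fun i =>
  (AddMonoidAlgebra.of K M).toHomUnits (Multiplicative.ofAdd (e i))

lemma charVal_latticePoint {r : ℕ} (K : Type) [Field K] {M : Type} [AddCommGroup M]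
    (e : Fin r → M) (χ : Fin r → ℤ) :
    (charVal (latticePoint K e) χ : AddMonoidAlgebra K M) =
      AddMonoidAlgebra.single (∑ i, χ i • e i) 1 := by
  have : charVal (latticePoint K e) χ =
      (AddMonoidAlgebra.of K M).toHomUnits (Multiplicative.ofAdd (∑ i, χ i • e i)) := by
    simp only [charVal, latticePoint, ← map_zpow, ← map_prod, ofAdd_sum, ofAdd_zsmul]
  rw [this]
  rfl

/-- A split torus acts diagonalizably: its points are combinations of orthogonal idempotent
matrices with coefficients the values of characters. -/
theorem exists_weights {K : Type} [Field K] {T : AlgGroup K n} {r : ℕ}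
    (φ : ∀ (R : Type) [CommRing R] [Algebra K R], (Fin r → Rˣ) ≃* T.points R)
    (hφ : ∀ (R R' : Type) [CommRing R] [Algebra K R] [CommRing R'] [Algebra K R'] (f : R →ₐ[K] R')
      (t : Fin r → Rˣ),
      Matrix.GeneralLinearGroup.map (f : R →+* R') (φ R t : GL n R) =
        (φ R' (fun i => Units.map (f : R →* R') (t i)) : GL n R')) :
    ∃ (W : Finset (Fin r → ℤ)) (P : (Fin r → ℤ) → Matrix n n K)
      (g : GL n (AddMonoidAlgebra K (Fin r → ℤ))),
      (∀ χ, P χ = (g : Matrix n n (AddMonoidAlgebra K (Fin r → ℤ))).map fun a => a.coeff χ) ∧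
      g ∈ T.points (AddMonoidAlgebra K (Fin r → ℤ)) ∧
      (∀ χ, P χ * P χ = P χ) ∧ (∀ χ ψ, χ ≠ ψ → P χ * P ψ = 0) ∧ ∑ χ ∈ W, P χ = 1 ∧
      (∀ χ, χ ∈ W ↔ P χ ≠ 0) ∧
      ∀ (R : Type) [CommRing R] [Algebra K R] (t : Fin r → Rˣ),
        ((φ R t : GL n R) : Matrix n n R) =
          ∑ χ ∈ W, (charVal t χ : R) • (P χ).map (algebraMap K R) := by
  classical
  -- The point τ is the universal point of the split torus, over its coordinate ring; P χ collects
  -- the coefficients of χ in the matrix φ(τ).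
  let τ := latticePoint K (fun i : Fin r => (Pi.single i 1 : Fin r → ℤ))
  let g : GL n (AddMonoidAlgebra K (Fin r → ℤ)) := φ _ τ
  let P : (Fin r → ℤ) → Matrix n n K := fun χ =>
    (g : Matrix n n (AddMonoidAlgebra K (Fin r → ℤ))).map fun a => a.coeff χ
  let W₀ : Finset (Fin r → ℤ) := Finset.univ.biUnion fun ij : n × n => (g ij.1 ij.2).coeff.support
  let W := W₀.filter fun χ => P χ ≠ 0
  have hW : ∀ χ, χ ∈ W ↔ P χ ≠ 0 := by
    intro χ
    simp only [W, Finset.mem_filter, and_iff_right_iff_imp]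
    intro hχ
    by_contra h
    apply hχ
    ext i j
    by_contra hij
    apply h
    simp only [W₀, Finset.mem_biUnion]
    exact ⟨(i, j), Finset.mem_univ _, Finsupp.mem_support_iff.2 hij⟩
  have hpt : ∀ (R : Type) [CommRing R] [Algebra K R] (t : Fin r → Rˣ),
        ((φ R t : GL n R) : Matrix n n R) =
          ∑ χ ∈ W, (charVal t χ : R) • (P χ).map (algebraMap K R) := by
    intro R _ _ t
    -- Every point t is the specialisation of τ along `charHom K t`, so naturality determines φ(t).
    have h1 := hφ _ R (charHom K t) τ
    have h2 : (fun i => Units.map (charHom K t : AddMonoidAlgebra K (Fin r → ℤ) →* R) (τ i)) = t := by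
      funext i
      apply Units.ext
      change charHom K t (AddMonoidAlgebra.single (Pi.single i 1) 1) = t i
      rw [charHom, AddMonoidAlgebra.lift_single]
      simp [charVal_single]
    rw [h2] at h1
    rw [← h1]
    ext i j
    change charHom K t (g i j) = _
    rw [charHom, AddMonoidAlgebra.lift_apply', Finsupp.sum_of_support_subset (s := W)]
    · simp only [Matrix.sum_apply, Matrix.smul_apply, Matrix.map_apply, smul_eq_mul, P]
      exact Finset.sum_congr rfl fun χ _ => mul_comm _ _
    · intro χ hχ
      rw [hW]
      intro h
      exact Finsupp.mem_support_iff.1 hχ (congrFun (congrFun h i) j)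
    · intro χ _
      simp
  have hmul : ∀ χ ψ, P χ * P ψ = if χ = ψ then P χ else 0 := by
    intro χ ψ
    -- Two independent universal points live over the group algebra of ℤʳ × ℤʳ. In φ(t₁)φ(t₂) =
    -- φ(t₁t₂) the coefficient of (χ, ψ) is P χ * P ψ on the left; on the right only diagonal pairs
    -- occur.
    let M := (Fin r → ℤ) × (Fin r → ℤ)
    let t₁ := latticePoint K (fun i : Fin r => ((Pi.single i 1, 0) : M))
    let t₂ := latticePoint K (fun i : Fin r => ((0, Pi.single i 1) : M))
    have hs (χ : Fin r → ℤ) : ∑ i, χ i • (Pi.single i 1 : Fin r → ℤ) = χ := by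
      funext k
      simp [Finset.sum_apply, Pi.single_apply]
    have c₁ (χ : Fin r → ℤ) : (charVal t₁ χ : AddMonoidAlgebra K M) =
        AddMonoidAlgebra.single (χ, 0) 1 := by
      rw [charVal_latticePoint]
      congr 1
      ext1
      · simpa [Prod.fst_sum] using hs χ
      · simp [Prod.snd_sum]
    have c₂ (χ : Fin r → ℤ) : (charVal t₂ χ : AddMonoidAlgebra K M) =
        AddMonoidAlgebra.single (0, χ) 1 := by
      rw [charVal_latticePoint]
      congr 1
      ext1
      · simp [Prod.fst_sum]
      · simpa [Prod.snd_sum] using hs χ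
    have h1 : ((φ (AddMonoidAlgebra K M) t₁ : GL n (AddMonoidAlgebra K M)) :
          Matrix n n (AddMonoidAlgebra K M)) *
        ((φ (AddMonoidAlgebra K M) t₂ : GL n (AddMonoidAlgebra K M)) :
          Matrix n n (AddMonoidAlgebra K M)) =
        ((φ (AddMonoidAlgebra K M) (t₁ * t₂) : GL n (AddMonoidAlgebra K M)) :
          Matrix n n (AddMonoidAlgebra K M)) := by
      rw [map_mul]; rfl
    rw [hpt, hpt, hpt] at h1
    simp only [charVal_mul, Units.val_mul, c₁, c₂, AddMonoidAlgebra.single_mul_single,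
      Finset.sum_mul_sum, Matrix.smul_mul, Matrix.mul_smul, smul_smul, Prod.mk_add_mk, zero_add,
      add_zero, mul_one, ← Matrix.map_mul] at h1
    ext i j
    have h2 := congrArg (fun A : Matrix n n (AddMonoidAlgebra K M) => (A i j).coeff (χ, ψ)) h1
    have h3 (x y : Fin r → ℤ) (a : K) : (AddMonoidAlgebra.single ((x, y) : M) (1 : K) •
        algebraMap K (AddMonoidAlgebra K M) a).coeff (χ, ψ) = if x = χ ∧ y = ψ then a else 0 := by
      rw [smul_eq_mul, mul_comm, ← Algebra.smul_def, AddMonoidAlgebra.smul_single]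
      simp [Finsupp.single_apply, M]
    simp only [Matrix.sum_apply, Matrix.smul_apply, Matrix.map_apply, AddMonoidAlgebra.coeff_sum,
      Finsupp.finsetSum_apply, h3] at h2
    have hout (ξ : Fin r → ℤ) (h : ξ ∉ W) : P ξ = 0 := by
      by_contra h'; exact h ((hW ξ).2 h')
    by_cases hχ : χ ∈ W
    · by_cases hψ : ψ ∈ W
      · have e1 : (∑ x ∈ W, ∑ y ∈ W, if (x = χ ∧ y = ψ) then (P x * P y) i j else 0) =
            (P χ * P ψ) i j := by
          rw [Finset.sum_eq_single χ, Finset.sum_eq_single ψ]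
          · simp
          · intro y _ hy; simp [hy]
          · exact fun h => absurd hψ h
          · intro x _ hx; simp [hx]
          · exact fun h => absurd hχ h
        have e2 : (∑ x ∈ W, if (x = χ ∧ x = ψ) then (P x) i j else 0) =
            (if χ = ψ then P χ else 0 : Matrix n n K) i j := by
          rw [Finset.sum_eq_single χ]
          · by_cases h : χ = ψ <;> simp [h]
          · intro x _ hx; simp [hx]
          · exact fun h => absurd hχ h
        exact e1.symm.trans (h2.trans e2)
      · rw [hout ψ hψ, mul_zero]
        split_ifs with h
        · rw [h, hout ψ hψ]
        · rfl
    · rw [hout χ hχ, zero_mul]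
      split_ifs <;> rfl
  refine ⟨W, P, g, fun _ => rfl, (φ _ τ).2, fun χ => by simp [hmul], fun χ ψ h => by simp [hmul, h],
    ?_, hW, hpt⟩
  -- The idempotents sum to 1 because φ maps the identity to the identity.
  have h1 := hpt K 1
  rw [map_one] at h1
  have h2 : ∀ χ : Fin r → ℤ, charVal (1 : Fin r → Kˣ) χ = 1 := fun χ => by simp [charVal]
  have h3 : ∀ χ, (P χ).map (algebraMap K K) = P χ := fun χ => by ext; simp
  simp only [h2, h3, Units.val_one, one_smul] at h1
  exact h1.symm

end Weights

end AlgGroup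

/-! ### Weights of split tori inside the quaternionic group -/

namespace QuatForm

section Weights

open AlgGroup

/-- Here f is only additive, which suffices because the matrix of left multiplication has integral
linear entries. Applied to the extraction of one coefficient, it shows that the weight idempotents
come from M₂(B ⊗ K). -/
lemma leftMul_extract_map {R R' : Type} [CommRing R] [CommRing R'] (f : R →+ R')
    (M : Matrix (Fin 2 × Fin 4) (Fin 2 × Fin 4) R) :
    leftMul R' (extract (M.map f)) = (leftMul R (extract M)).map f := by
  have h3 (a : R) : f (3 * a) = 3 * f a := by
    have e : (3 : R) * a = (3 : ℕ) • a := by simp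
    rw [e, map_nsmul]; simp
  ext ⟨p, a⟩ ⟨q, b⟩
  rw [Matrix.map_apply, leftMul_apply, leftMul_apply, leftMulMatrix_eq, leftMulMatrix_eq]
  fin_cases a <;> fin_cases b <;> simp [extract, h3]

lemma leftMul_injective (R : Type) [CommRing R] : Function.Injective (leftMul R) :=
  Function.LeftInverse.injective (g := extract) extract_leftMul

/-- The weight decomposition of a split torus in `G`, with idempotents in `M₂(B ⊗ K)`. -/
theorem exists_weights_group {K : Type} [Field K] {T : AlgGroup K (Fin 2 × Fin 4)}
    (hT : IsSubgroupOver K group T) {r : ℕ}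
    (φ : ∀ (R : Type) [CommRing R] [Algebra K R], (Fin r → Rˣ) ≃* T.points R)
    (hφ : ∀ (R R' : Type) [CommRing R] [Algebra K R] [CommRing R'] [Algebra K R'] (f : R →ₐ[K] R')
      (t : Fin r → Rˣ),
      Matrix.GeneralLinearGroup.map (f : R →+* R') (φ R t : GL (Fin 2 × Fin 4) R) =
        (φ R' (fun i => Units.map (f : R →* R') (t i)) : GL (Fin 2 × Fin 4) R')) :
    ∃ (W : Finset (Fin r → ℤ)) (x : (Fin r → ℤ) → Matrix (Fin 2) (Fin 2) (Quat K)),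
      (∀ χ, x χ * x χ = x χ) ∧ (∀ χ ψ, χ ≠ ψ → x χ * x ψ = 0) ∧ ∑ χ ∈ W, x χ = 1 ∧
      (∀ χ, χ ∈ W ↔ x χ ≠ 0) ∧
      ∀ (R : Type) [CommRing R] [Algebra K R] (t : Fin r → Rˣ),
        ((φ R t : GL (Fin 2 × Fin 4) R) : Matrix (Fin 2 × Fin 4) (Fin 2 × Fin 4) R) =
          ∑ χ ∈ W, (charVal t χ : R) • (leftMul K (x χ)).map (algebraMap K R) := by
  obtain ⟨W, P, g, hP, hg, h1, h2, h3, h4, h5⟩ := exists_weights φ hφ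
  have hx : ∀ χ, leftMul K (extract (P χ)) = P χ := by
    intro χ
    let f : AddMonoidAlgebra K (Fin r → ℤ) →+ K :=
      { toFun := fun a => a.coeff χ
        map_zero' := by simp
        map_add' := by simp }
    have e : P χ = (g : Matrix _ _ (AddMonoidAlgebra K (Fin r → ℤ))).map f := hP χ
    rw [e, leftMul_extract_map, ((mem_normOne_iff g).1 (hT _ hg)).1]
  have hinj := leftMul_injective K
  refine ⟨W, fun χ => extract (P χ), fun χ => hinj ?_, fun χ ψ h => hinj ?_, hinj ?_, fun χ => ?_,
    fun R _ _ t => ?_⟩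
  · rw [map_mul, hx, h1]
  · rw [map_mul, hx, hx, h2 χ ψ h, map_zero]
  · simp only [map_sum, hx, h3, map_one]
  · rw [h4, ← hx, Ne, Ne, map_eq_zero_iff _ hinj]
  · simp only [hx]; exact h5 R t

lemma two_zpow_eq_one {K : Type} [Field K] [CharZero K] {k : ℤ} (h : (2 : K) ^ k = 1) : k = 0 := by
  have h1 : (2 : ℚ) ^ k = 1 := by
    have : (((2 : ℚ) ^ k : ℚ) : K) = ((1 : ℚ) : K) := by push_cast; exact h
    exact_mod_cast this
  exact zpow_right_injective₀ (a := (2 : ℚ)) (by norm_num) (by norm_num) (by simpa using h1)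

lemma zpow_finset_sum {A ι : Type} [CommGroup A] (a : A) (s : Finset ι) (f : ι → ℤ) :
    a ^ (∑ i ∈ s, f i) = ∏ i ∈ s, a ^ f i := by
  classical
  induction s using Finset.induction_on with
  | empty => simp
  | insert i s hi ih => rw [Finset.sum_insert hi, Finset.prod_insert hi, zpow_add, ih]

lemma nrd_algebraMap {R : Type} [CommRing R] (c : R) :
    nrd R (algebraMap R _ c) = algebraMap R (QuadraticAlgebra R 3 0) (c ^ 4) := by
  rw [nrd_apply, AlgHom.commutes, Matrix.algebraMap_eq_diagonal, Matrix.det_diagonal]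
  simp

/-- A split torus in `G` with at most `m` weights has dimension less than `m`. -/
theorem succ_le_of_card_weights_le {K : Type} [Field K] [CharZero K]
    {T : AlgGroup K (Fin 2 × Fin 4)} (hT : IsSubgroupOver K group T) {r : ℕ}
    (φ : (Fin r → Kˣ) ≃* T.points K) {W : Finset (Fin r → ℤ)}
    {x : (Fin r → ℤ) → Matrix (Fin 2) (Fin 2) (Quat K)} (hsum : ∑ χ ∈ W, x χ = 1)
    (hφ : ∀ t : Fin r → Kˣ,
      ((φ t : GL (Fin 2 × Fin 4) K) : Matrix (Fin 2 × Fin 4) (Fin 2 × Fin 4) K) =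
          ∑ χ ∈ W, (charVal t χ : K) • leftMul K (x χ)) :
    r + 1 ≤ W.card := by
  -- A cocharacter v together with a constant goes to the function χ ↦ ⟨χ, v⟩ + constant on the
  -- weights. Injectivity bounds the rank r + 1 of the source by the number of weights.
  let f : (Option (Fin r) → ℤ) →ₗ[ℤ] (W → ℤ) :=
    { toFun := fun v χ => ∑ i, χ.1 i * v (some i) + v none
      map_add' := fun v w => by
        funext χ
        simp only [Pi.add_apply, mul_add, Finset.sum_add_distrib]; ring
      map_smul' := fun c v => by
        funext χ
        simp only [Pi.smul_apply, smul_eq_mul, RingHom.id_apply, mul_add, Finset.mul_sum]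
        congr 1
        exact Finset.sum_congr rfl fun i _ => by ring }
  have hf : Function.Injective f := by
    rw [← LinearMap.ker_eq_bot, LinearMap.ker_eq_bot']
    intro v hv
    let two : Kˣ := Units.mk0 2 two_ne_zero
    have htwo {k : ℤ} (hk : two ^ k = 1) : k = 0 := by
      refine two_zpow_eq_one (K := K) ?_
      have := congrArg Units.val hk
      simpa [two] using this
    -- For a kernel element, the cocharacter at 2 acts by the same scalar on every weight space. A
    -- scalar c has reduced norm c⁴, so the constant vanishes; then t acts trivially, so t = 1 and v
    -- = 0.
    let t : Fin r → Kˣ := fun i => two ^ v (some i)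
    have hc : ∀ χ ∈ W, charVal t χ = two ^ (-v none) := by
      intro χ hχ
      have h1 : ∑ i, χ i * v (some i) + v none = 0 := congrFun hv ⟨χ, hχ⟩
      rw [← eq_neg_of_add_eq_zero_left h1]
      simp only [charVal, t, ← zpow_mul]
      rw [zpow_finset_sum]
      exact Finset.prod_congr rfl fun i _ => by rw [mul_comm]
    have hval : ((φ t : GL (Fin 2 × Fin 4) K) : Matrix (Fin 2 × Fin 4) (Fin 2 × Fin 4) K) =
        leftMul K (algebraMap K _ ((two ^ (-v none) : Kˣ) : K)) := by
      rw [hφ, Finset.sum_congr rfl (fun χ hχ => by rw [hc χ hχ]), ← Finset.smul_sum, ← map_sum,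
        hsum, map_one, AlgHom.commutes, Algebra.algebraMap_eq_smul_one]
    have hnone : v none = 0 := by
      have h1 := ((mem_normOne_iff _).1 (hT K (φ t).2)).2
      rw [hval, extract_leftMul, nrd_algebraMap] at h1
      have h2 := congrArg QuadraticAlgebra.re h1
      have h3 : (((two ^ (-v none) : Kˣ) : K)) ^ 4 = 1 := by
        simpa [QuadraticAlgebra.re_one] using h2
      have h4 : (two ^ (-v none * 4) : Kˣ) = 1 := by
        apply Units.ext
        rw [zpow_mul]
        simpa only [Units.val_pow_eq_pow_val, zpow_ofNat, Units.val_one] using h3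
      have := htwo h4
      omega
    have ht : t = 1 := by
      apply φ.injective
      apply Subtype.ext
      apply Units.ext
      rw [hval, hnone, map_one]
      simp
    funext o
    cases o with
    | none => exact hnone
    | some i => exact htwo (congrFun ht i)
  have := card_le_of_injective ℤ f hf
  simpa using this

/-- A nonzero vector fixed by each idempotent can be chosen; orthogonality makes these vectors
linearly independent. -/
lemma card_le_of_orthogonal_idempotents {K : Type} [Field K] {m ι : Type} [Fintype m]
    [DecidableEq m] (W : Finset ι) (p : ι → Matrix m m K) (h0 : ∀ χ ∈ W, p χ ≠ 0)
    (h1 : ∀ χ, p χ * p χ = p χ) (h2 : ∀ χ ψ, χ ≠ ψ → p χ * p ψ = 0) :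
    W.card ≤ Fintype.card m := by
  have hw : ∀ χ : W, ∃ w : m → K, (p χ).mulVec w = w ∧ w ≠ 0 := by
    intro χ
    by_contra! hcon
    apply h0 χ.1 χ.2
    have : ∀ v, (p χ).mulVec v = 0 := fun v => hcon _ (by rw [Matrix.mulVec_mulVec, h1])
    ext i j
    simpa using congrFun (this (Pi.single j 1)) i
  choose w hw hw0 using hw
  have hli : LinearIndependent K w := by
    rw [Fintype.linearIndependent_iff]
    intro c hc χ
    have h3 := congrArg (p χ).mulVec hc
    rw [Matrix.mulVec_zero, Matrix.mulVec_sum, Finset.sum_eq_single χ] at h3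
    · rw [Matrix.mulVec_smul, hw] at h3
      exact (smul_eq_zero.1 h3).resolve_right (hw0 χ)
    · intro ψ _ hψ
      rw [Matrix.mulVec_smul, ← hw ψ, Matrix.mulVec_mulVec,
        h2 _ _ (fun h => hψ (Subtype.ext h.symm)), Matrix.zero_mulVec, smul_zero]
    · simp
  have := hli.fintype_card_le_finrank
  simpa using this

end Weights

/-! ### The rational quaternion algebra is a division algebra; idempotents in M₂ -/

section Division

/-- The form `a² + b² - 3c² - 3d²` is anisotropic over `ℤ`. -/
lemma int_sq_add_sq_eq_three_mul {a b c d : ℤ} (h : a ^ 2 + b ^ 2 = 3 * (c ^ 2 + d ^ 2)) :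
    c ^ 2 + d ^ 2 = 0 := by
  by_contra h0
  let N := c.natAbs ^ 2 + d.natAbs ^ 2
  have hN : (N : ℤ) = c ^ 2 + d ^ 2 := by simp [N]
  have hN0 : N ≠ 0 := by
    intro h1; rw [h1] at hN; exact h0 hN.symm
  have h3N : 3 * N = a.natAbs ^ 2 + b.natAbs ^ 2 := by
    zify
    rw [hN, sq_abs, sq_abs, h]
  -- Both N and 3N are sums of two squares and 3 ≡ 3 mod 4, so their 3-adic valuations are both
  -- even, yet they differ by one.
  have e1 : Even (padicValNat 3 N) := by
    by_cases hd : 3 ∣ N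
    · exact Nat.eq_sq_add_sq_iff.1 ⟨_, _, rfl⟩ 3
        (Nat.mem_primeFactors.2 ⟨Nat.prime_three, hd, hN0⟩) rfl
    · simp [padicValNat.eq_zero_of_not_dvd hd]
  have e2 : Even (padicValNat 3 (3 * N)) :=
    Nat.eq_sq_add_sq_iff.1 ⟨_, _, h3N⟩ 3
      (Nat.mem_primeFactors.2 ⟨Nat.prime_three, dvd_mul_right _ _, by positivity⟩) rfl
  have : Fact (Nat.Prime 3) := ⟨Nat.prime_three⟩
  rw [padicValNat.mul (by norm_num) hN0, padicValNat_self] at e2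
  rw [Nat.even_add] at e2
  exact absurd (e2.2 e1) (by decide)

lemma rat_sq_add_sq_eq_three_mul {a b c d : ℚ} (h : a ^ 2 + b ^ 2 = 3 * (c ^ 2 + d ^ 2)) :
    c ^ 2 + d ^ 2 = 0 := by
  have hden (q : ℚ) : q * q.den = q.num := Rat.mul_den_eq_num q
  let D : ℤ := a.den * b.den * c.den * d.den
  have hD : (D : ℚ) ≠ 0 := by simp [D]
  have ha : a * D = ((a.num * b.den * c.den * d.den : ℤ) : ℚ) := by
    simp only [D]; push_cast; rw [← hden a]; ring
  have hb : b * D = ((b.num * a.den * c.den * d.den : ℤ) : ℚ) := by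
    simp only [D]; push_cast; rw [← hden b]; ring
  have hc : c * D = ((c.num * a.den * b.den * d.den : ℤ) : ℚ) := by
    simp only [D]; push_cast; rw [← hden c]; ring
  have hd : d * D = ((d.num * a.den * b.den * c.den : ℤ) : ℚ) := by
    simp only [D]; push_cast; rw [← hden d]; ring
  have h1 : (a * D) ^ 2 + (b * D) ^ 2 = 3 * ((c * D) ^ 2 + (d * D) ^ 2) := by
    linear_combination (D : ℚ) ^ 2 * h
  rw [ha, hb, hc, hd] at h1
  have h2 := int_sq_add_sq_eq_three_mul (by exact_mod_cast h1)
  have h3 : (c * D) ^ 2 + (d * D) ^ 2 = 0 := by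
    rw [hc, hd]; exact_mod_cast h2
  have h4 : (D : ℚ) ^ 2 * (c ^ 2 + d ^ 2) = 0 := by linear_combination h3
  exact (mul_eq_zero.1 h4).resolve_left (pow_ne_zero 2 hD)

/-- The norm form is anisotropic over ℚ, so a nonzero p is cancelled by multiplying with its
conjugate. -/
instance noZeroDivisors_quat : NoZeroDivisors (Quat ℚ) where
  eq_zero_or_eq_zero_of_mul_eq_zero := by
    intro p q hpq
    by_cases hN : p.re ^ 2 + p.imI ^ 2 - 3 * (p.imJ ^ 2 + p.imK ^ 2) = 0
    · left
      have h1 : p.re ^ 2 + p.imI ^ 2 = 3 * (p.imJ ^ 2 + p.imK ^ 2) := by linarith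
      have h2 := rat_sq_add_sq_eq_three_mul h1
      rw [h2] at h1
      ext <;> simp <;> nlinarith [sq_nonneg p.re, sq_nonneg p.imI, sq_nonneg p.imJ,
        sq_nonneg p.imK]
    · right
      have h3 : (⟨p.re, -p.imI, -p.imJ, -p.imK⟩ : Quat ℚ) * (p * q) =
          (p.re ^ 2 + p.imI ^ 2 - 3 * (p.imJ ^ 2 + p.imK ^ 2)) • q := by
        ext <;> simp <;> ring
      rw [hpq, mul_zero] at h3
      exact (smul_eq_zero.1 h3.symm).resolve_left hN

/-- Nontrivial idempotents in `M₂(B ⊗ ℚ)` are conjugate to `diag(1, 0)`. -/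
lemma exists_unit_conj_of_idempotent {x : Matrix (Fin 2) (Fin 2) (Quat ℚ)} (hx : x * x = x)
    (h0 : x ≠ 0) (h1 : x ≠ 1) :
    ∃ u v : Matrix (Fin 2) (Fin 2) (Quat ℚ),
      u * v = 1 ∧ v * u = 1 ∧ x * u = u * Matrix.diagonal ![1, 0] := by
  obtain ⟨p, q, hpq⟩ : ∃ p q, x p q ≠ 0 := by
    by_contra! h; exact h0 (Matrix.ext h)
  obtain ⟨p', q', hpq'⟩ : ∃ p q, (1 - x) p q ≠ 0 := by
    by_contra! h; exact h1 (sub_eq_zero.1 (Matrix.ext h)).symm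
  -- The columns of u are a nonzero column of x, fixed by x, and a nonzero column of 1 - x, killed
  -- by x.
  let u : Matrix (Fin 2) (Fin 2) (Quat ℚ) := Matrix.of fun a => ![x a q, (1 - x) a q']
  have hxu : x * u = u * Matrix.diagonal ![1, 0] := by
    have hx' : x * (1 - x) = 0 := by rw [mul_sub, hx, mul_one, sub_self]
    ext1 a b
    rw [Matrix.mul_diagonal]
    fin_cases b
    · have := congrFun (congrFun hx a) q
      rw [Matrix.mul_apply] at this
      simpa [Matrix.mul_apply, u] using this
    · have := congrFun (congrFun hx' a) q'
      rw [Matrix.mul_apply] at this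
      simpa [Matrix.mul_apply, u] using this
  have hker : ∀ y, u * y = 0 → y = 0 := by
    intro y hy
    have h2 : u * (Matrix.diagonal ![1, 0] * y) = 0 := by
      rw [← mul_assoc, ← hxu, mul_assoc, hy, mul_zero]
    have hy0 : ∀ c, y 0 c = 0 := by
      intro c
      have := congrFun (congrFun h2 p) c
      rw [Matrix.mul_apply] at this
      simpa [u, hpq] using this
    have hy1 : ∀ c, y 1 c = 0 := by
      intro c
      have := congrFun (congrFun hy p') c
      rw [Matrix.mul_apply, Fin.sum_univ_two, hy0, mul_zero, zero_add] at this
      exact (mul_eq_zero.1 this).resolve_left hpq'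
    ext1 a c
    fin_cases a
    · exact hy0 c
    · exact hy1 c
  -- Left multiplication by u is an injective endomorphism of a finite-dimensional ℚ-space, hence
  -- surjective; this gives the inverse.
  have hinj : Function.Injective (LinearMap.mulLeft ℚ u) := by
    rw [← LinearMap.ker_eq_bot, LinearMap.ker_eq_bot']
    exact hker
  obtain ⟨y, hy⟩ := LinearMap.injective_iff_surjective.1 hinj 1
  have hy' : u * y = 1 := hy
  refine ⟨u, y, hy', ?_, hxu⟩
  have : u * (y * u - 1) = 0 := by rw [mul_sub, ← mul_assoc, hy', one_mul, mul_one, sub_self]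
  exact sub_eq_zero.1 (hker _ this)

/-- Two nonzero orthogonal idempotents in `M₂(B ⊗ ℚ)` are complementary. -/
lemma add_eq_one_of_orthogonal {x y : Matrix (Fin 2) (Fin 2) (Quat ℚ)} (hx : x * x = x)
    (hy : y * y = y) (hxy : x * y = 0) (hyx : y * x = 0) (hx0 : x ≠ 0) (hy0 : y ≠ 0) :
    x + y = 1 := by
  have hx1 : x ≠ 1 := by
    rintro rfl; exact hy0 (by rwa [one_mul] at hxy)
  obtain ⟨u, v, huv, hvu, hu⟩ := exists_unit_conj_of_idempotent hx hx0 hx1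
  set E : Matrix (Fin 2) (Fin 2) (Quat ℚ) := Matrix.diagonal ![1, 0] with hE
  have hux : E = v * x * u := by rw [mul_assoc, hu, ← mul_assoc, hvu, one_mul]
  have hconj (a b : Matrix (Fin 2) (Fin 2) (Quat ℚ)) : v * a * u * (v * b * u) = v * (a * b) * u := by
    calc v * a * u * (v * b * u) = v * (a * (u * v) * b) * u := by simp only [mul_assoc]
      _ = _ := by rw [huv, mul_one]
  -- After conjugating x to diag(1, 0), orthogonality leaves y only its lower right entry, an
  -- idempotent of a division algebra.
  obtain ⟨z, hzdef⟩ : ∃ z, z = v * y * u := ⟨_, rfl⟩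
  have hz : z * z = z := by rw [hzdef, hconj, hy]
  have hEz : E * z = 0 := by rw [hzdef, hux, hconj, hxy, mul_zero, zero_mul]
  have hzE : z * E = 0 := by rw [hzdef, hux, hconj, hyx, mul_zero, zero_mul]
  have hyz : y = u * z * v := by
    calc y = (u * v) * y * (u * v) := by rw [huv, one_mul, mul_one]
      _ = _ := by rw [hzdef]; simp only [mul_assoc]
  have z0 : ∀ c, z 0 c = 0 := fun c => by
    have := congrFun (congrFun hEz 0) c
    rw [hE, Matrix.diagonal_mul] at this
    simpa using this
  have z10 : z 1 0 = 0 := by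
    have := congrFun (congrFun hzE 1) 0
    rw [hE, Matrix.mul_diagonal] at this
    simpa using this
  have z11 : z 1 1 = 1 := by
    have h2 := congrFun (congrFun hz 1) 1
    rw [Matrix.mul_apply, Fin.sum_univ_two, z0, mul_zero, zero_add] at h2
    have h3 : z 1 1 * (z 1 1 - 1) = 0 := by rw [mul_sub, h2, mul_one, sub_self]
    rcases mul_eq_zero.1 h3 with h | h
    · refine absurd ?_ hy0
      have : z = 0 := by
        ext1 a b
        fin_cases a
        · exact z0 b
        · fin_cases b
          · exact z10
          · exact h
      rw [hyz, this, mul_zero, zero_mul]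
    · exact sub_eq_zero.1 h
  have hEz1 : E + z = 1 := by
    ext1 a b
    fin_cases a <;> fin_cases b <;> simp [hE, z0, z10, z11]
  have hxE : x = u * E * v := by rw [← hu, mul_assoc, huv, mul_one]
  rw [hyz, hxE, ← add_mul, ← mul_add, hEz1, mul_one, huv]

end Division

end QuatForm

/-! ### Split tori over ℚ -/

namespace QuatForm

open AlgGroup

section Ranks

lemma finTwo_diagonal_algebraMap {R : Type} [CommRing R] (a b : R) :
    leftMul R (Matrix.diagonal ![algebraMap R (Quat R) a, algebraMap R (Quat R) b]) =
      Matrix.diagonal fun pa : Fin 2 × Fin 4 => if pa.1 = 0 then a else b := by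
  ext ⟨p, i⟩ ⟨q, j⟩
  rw [leftMul_apply, leftMulMatrix_eq]
  fin_cases p <;> fin_cases q <;> fin_cases i <;> fin_cases j <;> simp

lemma nrd_diagonal {R : Type} [CommRing R] (a b : R) :
    nrd R (Matrix.diagonal ![algebraMap R (Quat R) a, algebraMap R (Quat R) b]) =
      algebraMap R (QuadraticAlgebra R 3 0) ((a * b) ^ 2) := by
  have h : iota R (QuadraticAlgebra.omega : QuadraticAlgebra R 3 0) (omega_sq R)
      (Matrix.diagonal ![algebraMap R (Quat R) a, algebraMap R (Quat R) b]) =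
      Matrix.diagonal ![algebraMap R _ a, algebraMap R _ a, algebraMap R _ b, algebraMap R _ b] := by
    refine matrix_ext_blk fun p i q j => ?_
    rw [iota_blk, liftHom_eq]
    have e0 : blk 0 0 = 0 := rfl
    have e1 : blk 0 1 = 1 := rfl
    have e2 : blk 1 0 = 2 := rfl
    have e3 : blk 1 1 = 3 := rfl
    fin_cases p <;> fin_cases i <;> fin_cases q <;> fin_cases j <;>
      simp [e0, e1, e2, e3]
  rw [nrd_apply, h, Matrix.det_diagonal, Fin.prod_univ_four]
  simp only [Matrix.cons_val, map_mul, map_pow]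
  ring

lemma diagUnits_val {R : Type} [CommRing R] (t : Rˣ) :
    (diagUnits R t : Matrix (Fin 2) (Fin 2) (Quat R)) =
      Matrix.diagonal ![algebraMap R (Quat R) t, algebraMap R (Quat R) ↑t⁻¹] := rfl

lemma leftMulUnits_diagUnits_mem {R : Type} [CommRing R] (t : Rˣ) :
    leftMulUnits R (diagUnits R t) ∈ normOne R := by
  rw [leftMulUnits_mem_normOne_iff, diagUnits_val, nrd_diagonal]
  simp

lemma torus_isSubgroupOver : IsSubgroupOver ℚ group torus := by
  rintro R _ _ _ ⟨t, rfl⟩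
  exact leftMulUnits_diagUnits_mem t

lemma diag_injective (R : Type) [CommRing R] :
    Function.Injective ((leftMulUnits R).comp (diagUnits R)) := by
  intro t u h
  have := congrArg (fun g : GL (Fin 2 × Fin 4) R =>
    (g : Matrix (Fin 2 × Fin 4) (Fin 2 × Fin 4) R) (0, 0) (0, 0)) h
  simp only [MonoidHom.comp_apply, leftMul_diagUnits, Matrix.diagonal_apply_eq] at this
  exact Units.ext (by simpa using this)

lemma torus_isSplitTorusOfDim : torus.IsSplitTorusOfDim 1 := by
  refine ⟨fun R _ _ => (MulEquiv.funUnique (Fin 1) Rˣ).trans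
    (MonoidHom.ofInjective (diag_injective R)), fun R R' _ _ _ _ f t => ?_⟩
  apply Units.ext
  change ((leftMulUnits R (diagUnits R (t 0)) : GL (Fin 2 × Fin 4) R) :
    Matrix (Fin 2 × Fin 4) (Fin 2 × Fin 4) R).map f =
    ((leftMulUnits R' (diagUnits R' (Units.map (f : R →* R') (t 0))) : GL (Fin 2 × Fin 4) R') :
    Matrix (Fin 2 × Fin 4) (Fin 2 × Fin 4) R')
  rw [leftMul_diagUnits, leftMul_diagUnits, Matrix.diagonal_map (map_zero f)]
  congr 1
  funext pa
  by_cases h : pa.1 = 0 <;> simp [h]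

/-- Split tori over `ℚ` in `G` have dimension at most one. -/
lemma dim_le_one {T : AlgGroup ℚ (Fin 2 × Fin 4)} (hT : IsSubgroupOver ℚ group T) {r : ℕ}
    (hr : T.IsSplitTorusOfDim r) : r ≤ 1 := by
  obtain ⟨φ, hφ⟩ := hr
  obtain ⟨W, x, h1, h2, h3, h4, h5⟩ := exists_weights_group hT φ hφ
  have h6 := succ_le_of_card_weights_le hT (φ ℚ) h3 (fun t => by
    rw [h5]; simp)
  by_contra hr
  have h7 : 2 < W.card := by omega
  obtain ⟨a, ha, b, hb, c, hc, hab, hac, hbc⟩ := Finset.two_lt_card.1 h7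
  -- Two of the idempotents already sum to 1, so a third one, orthogonal to both, would vanish.
  have h8 := add_eq_one_of_orthogonal (h1 a) (h1 b) (h2 a b hab) (h2 b a hab.symm)
    ((h4 a).1 ha) ((h4 b).1 hb)
  apply (h4 c).1 hc
  rw [← mul_one (x c), ← h8, mul_add, h2 c a hac.symm, h2 c b hbc.symm, add_zero]

/-- The `ℚ`-rank of `G` is one. -/
lemma hasSplitRank_rat : HasSplitRank ℚ group 1 :=
  ⟨⟨torus, torus_isSubgroupOver, torus_isSplitTorusOfDim⟩, fun _ ⟨_, h, h'⟩ => dim_le_one h h'⟩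

/-- The structure of a one-dimensional split torus over `ℚ` in `G`. -/
lemma exists_idempotent_of_dim_one {T : AlgGroup ℚ (Fin 2 × Fin 4)}
    (hT : IsSubgroupOver ℚ group T)
    (φ : ∀ (R : Type) [CommRing R] [Algebra ℚ R], (Fin 1 → Rˣ) ≃* T.points R)
    (hφ : ∀ (R R' : Type) [CommRing R] [Algebra ℚ R] [CommRing R'] [Algebra ℚ R'] (f : R →ₐ[ℚ] R')
      (t : Fin 1 → Rˣ),
      Matrix.GeneralLinearGroup.map (f : R →+* R') (φ R t : GL (Fin 2 × Fin 4) R) =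
        (φ R' (fun i => Units.map (f : R →* R') (t i)) : GL (Fin 2 × Fin 4) R')) :
    ∃ (x : Matrix (Fin 2) (Fin 2) (Quat ℚ)) (m : ℤ), x * x = x ∧ x ≠ 0 ∧ x ≠ 1 ∧ Odd m ∧
      ∀ (R : Type) [CommRing R] [Algebra ℚ R] (t : Fin 1 → Rˣ),
        ((φ R t : GL (Fin 2 × Fin 4) R) : Matrix (Fin 2 × Fin 4) (Fin 2 × Fin 4) R) =
          ((t 0 ^ m : Rˣ) : R) • (leftMul ℚ x).map (algebraMap ℚ R) +
            (((t 0 ^ m)⁻¹ : Rˣ) : R) • (leftMul ℚ (1 - x)).map (algebraMap ℚ R) := by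
  obtain ⟨W, x, h1, h2, h3, h4, h5⟩ := exists_weights_group hT φ hφ
  have h6 := succ_le_of_card_weights_le hT (φ ℚ) h3 (fun t => by
    rw [h5]; simp)
  obtain ⟨a, ha, b, hb, hab⟩ := Finset.one_lt_card.1 (by omega : 1 < W.card)
  have h7 := add_eq_one_of_orthogonal (h1 a) (h1 b) (h2 a b hab) (h2 b a hab.symm)
    ((h4 a).1 ha) ((h4 b).1 hb)
  have hW : W = {a, b} := by
    ext c
    rw [Finset.mem_insert, Finset.mem_singleton]
    refine ⟨fun hc => ?_, ?_⟩
    · by_contra! hne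
      apply (h4 c).1 hc
      rw [← mul_one (x c), ← h7, mul_add, h2 c a hne.1, h2 c b hne.2, add_zero]
    · rintro (rfl | rfl)
      exacts [ha, hb]
  have hxa1 : x a ≠ 1 := fun h => (h4 b).1 hb (by rwa [h, add_eq_left] at h7)
  have hxb : x b = 1 - x a := eq_sub_of_add_eq' h7
  have hval : ∀ (R : Type) [CommRing R] [Algebra ℚ R] (t : Fin 1 → Rˣ),
        ((φ R t : GL (Fin 2 × Fin 4) R) : Matrix (Fin 2 × Fin 4) (Fin 2 × Fin 4) R) =
          ((t 0 ^ a 0 : Rˣ) : R) • (leftMul ℚ (x a)).map (algebraMap ℚ R) +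
            ((t 0 ^ b 0 : Rˣ) : R) • (leftMul ℚ (1 - x a)).map (algebraMap ℚ R) := by
    intro R _ _ t
    rw [h5, hW, Finset.sum_pair hab, hxb]
    simp [charVal]
  -- At t = 2 the point is conjugate to diag(2ᵃ, 2ᵇ), with reduced norm 2²⁽ᵃ⁺ᵇ⁾ = 1.
  have hba : b 0 = -a 0 := by
    obtain ⟨u, v, huv, hvu, hu⟩ := exists_unit_conj_of_idempotent (h1 a) ((h4 a).1 ha) hxa1
    let two : ℚˣ := Units.mk0 2 two_ne_zero
    let A : ℚ := ((two ^ a 0 : ℚˣ) : ℚ)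
    let B : ℚ := ((two ^ b 0 : ℚˣ) : ℚ)
    have e1 : ((φ ℚ (fun _ => two) : GL (Fin 2 × Fin 4) ℚ) :
        Matrix (Fin 2 × Fin 4) (Fin 2 × Fin 4) ℚ) =
        leftMul ℚ (A • x a + B • (1 - x a)) := by
      rw [hval]
      simp [A, B]
    have e2 := ((mem_normOne_iff _).1 (hT ℚ (φ ℚ fun _ => two).2)).2
    have e3 : A • x a + B • (1 - x a) =
        u * Matrix.diagonal ![algebraMap ℚ (Quat ℚ) A, algebraMap ℚ (Quat ℚ) B] * v := by
      have hx : x a = u * Matrix.diagonal ![1, 0] * v := by rw [← hu, mul_assoc, huv, mul_one]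
      have h1x : 1 - x a = u * Matrix.diagonal ![0, 1] * v := by
        have : (Matrix.diagonal ![0, 1] : Matrix (Fin 2) (Fin 2) (Quat ℚ)) =
            1 - Matrix.diagonal ![1, 0] := by
          ext1 i j; fin_cases i <;> fin_cases j <;> simp
        rw [this, mul_sub, sub_mul, mul_one, huv, ← hx]
      have hc (c : ℚ) (D : Matrix (Fin 2) (Fin 2) (Quat ℚ)) :
          c • (u * D * v) = u * (c • D) * v := by rw [Matrix.mul_smul, Matrix.smul_mul]
      rw [h1x, hx, hc, hc, ← add_mul, ← mul_add]
      congr 2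
      ext1 i j
      fin_cases i <;> fin_cases j <;> simp [Algebra.algebraMap_eq_smul_one]
    rw [e1, extract_leftMul, e3, map_mul, map_mul, mul_right_comm, ← map_mul, huv, map_one,
      one_mul, nrd_diagonal] at e2
    have e4 : (A * B) ^ 2 = 1 := congrArg QuadraticAlgebra.re e2
    have e5 : (2 : ℚ) ^ ((a 0 + b 0) * 2) = 1 := by
      rw [zpow_mul, zpow_add₀ two_ne_zero]
      simpa [A, B, two] using e4
    have := two_zpow_eq_one e5
    omega
  refine ⟨x a, a 0, h1 a, (h4 a).1 ha, hxa1, ?_, fun R _ _ t => ?_⟩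
  -- With an even weight, t = -1 would act trivially, against injectivity of φ.
  · by_contra hodd
    rw [Int.not_odd_iff_even] at hodd
    have e1 : φ ℚ (fun _ => -1) = φ ℚ 1 := by
      apply Subtype.ext
      apply Units.ext
      rw [hval, hval]
      simp [hba, hodd.neg_one_zpow]
    have e2 := congrFun ((φ ℚ).injective e1) 0
    have e3 : (-1 : ℚ) = 1 := congrArg Units.val e2
    norm_num at e3
  · rw [hval, hba, zpow_neg]

/-- The torus `diag(t, t⁻¹)` is a maximal split torus over `ℚ`. -/
lemma torus_isMaximalSplitTorus : IsMaximalSplitTorus ℚ group torus := by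
  refine ⟨⟨torus_isSubgroupOver, 1, torus_isSplitTorusOfDim⟩, ?_⟩
  rintro T hT ⟨d, hd⟩ hle
  have hd1 := dim_le_one hT hd
  obtain ⟨φ, hφ⟩ := hd
  let two : ℚˣ := Units.mk0 2 two_ne_zero
  have hmem : leftMulUnits ℚ (diagUnits ℚ two) ∈ T.points ℚ := hle ℚ ⟨two, rfl⟩
  obtain ⟨t, ht⟩ := (φ ℚ).surjective ⟨_, hmem⟩
  have ht' : ((φ ℚ t : GL (Fin 2 × Fin 4) ℚ)) = leftMulUnits ℚ (diagUnits ℚ two) :=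
    congrArg Subtype.val ht
  interval_cases d
  · exfalso
    have h1 : t = 1 := Subsingleton.elim _ _
    rw [h1, map_one] at ht'
    have h2 : (1 : ℚˣ) = two := diag_injective ℚ (by rw [map_one]; exact ht')
    have h3 : (1 : ℚ) = 2 := congrArg Units.val h2
    norm_num at h3
  · obtain ⟨x, m, hx, hx0, hx1, -, hval⟩ := exists_idempotent_of_dim_one hT φ hφ
    have h1 : (Matrix.diagonal ![algebraMap ℚ (Quat ℚ) 2, algebraMap ℚ (Quat ℚ) 2⁻¹]) =
        ((t 0 ^ m : ℚˣ) : ℚ) • x + (((t 0 ^ m)⁻¹ : ℚˣ) : ℚ) • (1 - x) := by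
      apply leftMul_injective
      have := congrArg Units.val ht'
      rw [hval] at this
      rw [map_add, map_smul, map_smul]
      refine Eq.trans ?_ (this.symm.trans ?_)
      · change leftMul ℚ (diagUnits ℚ two : Matrix (Fin 2) (Fin 2) (Quat ℚ)) = _
        rfl
      · simp
    -- The element diag(2, 1/2) of T is a combination of x and 1 - x, so it commutes with x. Its two
    -- entries are distinct scalars, so x is diagonal, with idempotent entries 0 or 1 in a division
    -- algebra.
    have hcomm : x * Matrix.diagonal ![algebraMap ℚ (Quat ℚ) 2, algebraMap ℚ (Quat ℚ) 2⁻¹] =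
        Matrix.diagonal ![algebraMap ℚ (Quat ℚ) 2, algebraMap ℚ (Quat ℚ) 2⁻¹] * x := by
      rw [h1]
      simp only [mul_add, add_mul, Matrix.mul_smul, Matrix.smul_mul, mul_sub, sub_mul, hx, mul_one,
        one_mul]
    have h01 : x 0 1 = 0 := by
      have := congrFun (congrFun hcomm 0) 1
      rw [Matrix.mul_diagonal, Matrix.diagonal_mul] at this
      simp only [Matrix.cons_val_zero, Matrix.cons_val_one, ← Algebra.commutes,
        ← Algebra.smul_def] at this
      have h2 : ((2 : ℚ)⁻¹ - 2) • x 0 1 = 0 := by rw [sub_smul, this, sub_self]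
      exact (smul_eq_zero.1 h2).resolve_left (by norm_num)
    have h10 : x 1 0 = 0 := by
      have := congrFun (congrFun hcomm 1) 0
      rw [Matrix.mul_diagonal, Matrix.diagonal_mul] at this
      simp only [Matrix.cons_val_zero, Matrix.cons_val_one, ← Algebra.commutes,
        ← Algebra.smul_def] at this
      have h2 : ((2 : ℚ)⁻¹ - 2) • x 1 0 = 0 := by rw [sub_smul, this, sub_self]
      exact (smul_eq_zero.1 h2).resolve_left (by norm_num)
    have hidem : ∀ a, x a a = 0 ∨ x a a = 1 := by
      intro a
      have h2 : x a a * x a a = x a a := by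
        have := congrFun (congrFun hx a) a
        rw [Matrix.mul_apply, Fin.sum_univ_two] at this
        fin_cases a
        · simpa [h01] using this
        · simpa [h01] using this
      have h3 : x a a * (x a a - 1) = 0 := by rw [mul_sub, h2, mul_one, sub_self]
      exact (mul_eq_zero.1 h3).imp id sub_eq_zero.1
    have hext : ∀ a b : ℚ, x 0 0 = algebraMap ℚ _ a → x 1 1 = algebraMap ℚ _ b →
        x = Matrix.diagonal ![algebraMap ℚ (Quat ℚ) a, algebraMap ℚ (Quat ℚ) b] := by
      intro a b ha hb
      ext1 i j
      fin_cases i <;> fin_cases j <;> simp [h01, h10, ha, hb]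
    have hsub : ∀ a b : ℚ, (1 : Matrix (Fin 2) (Fin 2) (Quat ℚ)) -
        Matrix.diagonal ![algebraMap ℚ (Quat ℚ) a, algebraMap ℚ (Quat ℚ) b] =
        Matrix.diagonal ![algebraMap ℚ (Quat ℚ) (1 - a), algebraMap ℚ (Quat ℚ) (1 - b)] := by
      intro a b
      ext1 i j
      fin_cases i <;> fin_cases j <;> simp
    have hone : algebraMap ℚ (Quat ℚ) 1 = 1 := map_one _
    have hzero : algebraMap ℚ (Quat ℚ) 0 = 0 := map_zero _
    intro R _ _ g hg
    obtain ⟨τ, hτ⟩ := (φ R).surjective ⟨g, hg⟩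
    have hgτ : g = φ R τ := (congrArg Subtype.val hτ).symm
    rcases hidem 0 with e0 | e0 <;> rcases hidem 1 with e1 | e1
    · exact absurd ((hext 0 0 (by rw [e0, hzero]) (by rw [e1, hzero])).trans
        (by ext1 i j; fin_cases i <;> fin_cases j <;> simp)) hx0
    · refine ⟨(τ 0 ^ m)⁻¹, ?_⟩
      apply Units.ext
      rw [MonoidHom.comp_apply, leftMul_diagUnits, hgτ, hval,
        hext 0 1 (by rw [e0, hzero]) (by rw [e1, hone]), hsub, finTwo_diagonal_algebraMap,
        finTwo_diagonal_algebraMap, inv_inv]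
      ext i j
      simp only [Matrix.diagonal_apply, Matrix.add_apply, Matrix.smul_apply, Matrix.map_apply]
      by_cases hij : i = j <;> by_cases hi : i.1 = 0 <;> simp [hij] <;> simp_all
    · refine ⟨τ 0 ^ m, ?_⟩
      apply Units.ext
      rw [MonoidHom.comp_apply, leftMul_diagUnits, hgτ, hval,
        hext 1 0 (by rw [e0, hone]) (by rw [e1, hzero]), hsub, finTwo_diagonal_algebraMap,
        finTwo_diagonal_algebraMap]
      ext i j
      simp only [Matrix.diagonal_apply, Matrix.add_apply, Matrix.smul_apply, Matrix.map_apply]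
      by_cases hij : i = j <;> by_cases hi : i.1 = 0 <;> simp [hij] <;> simp_all
    · exact absurd ((hext 1 1 (by rw [e0, hone]) (by rw [e1, hone])).trans
        (by ext1 i j; fin_cases i <;> fin_cases j <;> simp)) hx1

end Ranks

end QuatForm

/-! ### Split tori over ℝ -/

namespace QuatForm

open AlgGroup

section RealRank

lemma algebraMap_sqrt_three_sq (R : Type) [CommRing R] [Algebra ℝ R] :
    algebraMap ℝ R √3 * algebraMap ℝ R √3 = 3 := by
  rw [← map_mul, sqrt_three_sq, map_ofNat]

lemma algebraMap_sixth (R : Type) [CommRing R] [Algebra ℝ R] :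
    algebraMap ℝ R (1 / 6) * 6 = 1 := by
  rw [← map_ofNat (algebraMap ℝ R) 6, ← map_mul]; norm_num

/-- The isomorphism of the group of points of `G` in an `ℝ`-algebra with `SL₄`. -/
abbrev pointsEquiv (R : Type) [CommRing R] [Algebra ℝ R] :
    normOne R ≃* Matrix.SpecialLinearGroup (Fin 4) R :=
  normOneEquiv (algebraMap ℝ R √3) (algebraMap_sqrt_three_sq R) (algebraMap ℝ R (1 / 6))
    (algebraMap_sixth R)

/-- The diagonal torus of `SL₄`. -/
def slDiag (R : Type) [CommRing R] : (Fin 3 → Rˣ) →* Matrix.SpecialLinearGroup (Fin 4) R where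
  toFun t := ⟨Matrix.diagonal fun i => ((![t 0, t 1, t 2, (t 0 * t 1 * t 2)⁻¹] i : Rˣ) : R), by
    rw [Matrix.det_diagonal, Fin.prod_univ_four]
    simp only [Matrix.cons_val, ← Units.val_mul, mul_inv_cancel, Units.val_one]⟩
  map_one' := by
    apply Subtype.ext
    change Matrix.diagonal _ = 1
    rw [← Matrix.diagonal_one]
    congr 1; funext i; fin_cases i <;> simp
  map_mul' t u := by
    apply Subtype.ext
    change Matrix.diagonal _ = Matrix.diagonal _ * Matrix.diagonal _
    rw [Matrix.diagonal_mul_diagonal]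
    congr 1; funext i; fin_cases i <;> simp
    ring

lemma slDiag_coe {R : Type} [CommRing R] (t : Fin 3 → Rˣ) :
    (slDiag R t : Matrix (Fin 4) (Fin 4) R) =
      Matrix.diagonal fun i => ((![t 0, t 1, t 2, (t 0 * t 1 * t 2)⁻¹] i : Rˣ) : R) := rfl

lemma slDiag_injective (R : Type) [CommRing R] : Function.Injective (slDiag R) := by
  intro t u h
  have h1 := fun i => congrFun (congrFun (congrArg Subtype.val h) i) i
  simp only [slDiag_coe, Matrix.diagonal_apply_eq] at h1
  funext i
  apply Units.ext
  fin_cases i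
  · exact h1 0
  · exact h1 1
  · exact h1 2

/-- The diagonal torus of `SL₄` as a group of points of `G`. -/
def realTorusHom (R : Type) [CommRing R] [Algebra ℝ R] :
    (Fin 3 → Rˣ) →* GL (Fin 2 × Fin 4) R :=
  (normOne R).subtype.comp ((pointsEquiv R).symm.toMonoidHom.comp (slDiag R))

lemma realTorusHom_injective (R : Type) [CommRing R] [Algebra ℝ R] :
    Function.Injective (realTorusHom R) :=
  Subtype.val_injective.comp ((pointsEquiv R).symm.injective.comp (slDiag_injective R))

lemma realTorusHom_coe {R : Type} [CommRing R] [Algebra ℝ R] (t : Fin 3 → Rˣ) :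
    (realTorusHom R t : Matrix (Fin 2 × Fin 4) (Fin 2 × Fin 4) R) =
      leftMul R (iotaInv (algebraMap ℝ R √3) (algebraMap ℝ R (1 / 6)) (slDiag R t)) := rfl

/-- This replaces the parametrisation by equations, as needed for `realTorus` to be closed; a
diagonal matrix of determinant one automatically has unit entries. -/
lemma mem_range_realTorusHom {R : Type} [CommRing R] [Algebra ℝ R] (g : GL (Fin 2 × Fin 4) R) :
    g ∈ (realTorusHom R).range ↔ g ∈ normOne R ∧ ∀ a b, a ≠ b →
      iota R (algebraMap ℝ R √3) (algebraMap_sqrt_three_sq R)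
        (extract (g : Matrix (Fin 2 × Fin 4) (Fin 2 × Fin 4) R)) a b = 0 := by
  constructor
  · rintro ⟨t, rfl⟩
    refine ⟨((pointsEquiv R).symm (slDiag R t)).2, fun a b hab => ?_⟩
    rw [realTorusHom_coe, extract_leftMul,
      iota_iotaInv _ _ _ (algebraMap_sixth R), slDiag_coe, Matrix.diagonal_apply_ne _ hab]
  · rintro ⟨hg, h⟩
    let M := pointsEquiv R ⟨g, hg⟩
    have hM : ∀ a b, a ≠ b → M a b = 0 := h
    have hd : M.1 = Matrix.diagonal fun i => M i i := by
      ext a b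
      by_cases hab : a = b
      · subst hab; rw [Matrix.diagonal_apply_eq]
      · rw [Matrix.diagonal_apply_ne _ hab]; exact hM a b hab
    have hdet : M 0 0 * M 1 1 * M 2 2 * M 3 3 = 1 := by
      have := M.2
      rw [hd, Matrix.det_diagonal, Fin.prod_univ_four] at this
      exact this
    let u0 : Rˣ := ⟨M 0 0, M 1 1 * M 2 2 * M 3 3, by linear_combination hdet,
      by linear_combination hdet⟩
    let u1 : Rˣ := ⟨M 1 1, M 0 0 * M 2 2 * M 3 3, by linear_combination hdet,
      by linear_combination hdet⟩
    let u2 : Rˣ := ⟨M 2 2, M 0 0 * M 1 1 * M 3 3, by linear_combination hdet,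
      by linear_combination hdet⟩
    have h3 : ((u0 * u1 * u2)⁻¹ : Rˣ) = M 3 3 := by
      rw [Units.inv_eq_of_mul_eq_one_right]
      exact hdet
    have hS : slDiag R ![u0, u1, u2] = M := by
      apply Subtype.ext
      rw [slDiag_coe, hd]
      congr 1
      funext i
      fin_cases i
      · rfl
      · rfl
      · rfl
      · exact h3
    refine ⟨![u0, u1, u2], ?_⟩
    change (((pointsEquiv R).symm (slDiag R ![u0, u1, u2]) : normOne R) : GL _ R) = g
    rw [hS]
    simp [M]

/-- A maximal split torus of `G` over `ℝ`: the diagonal torus of `SL₄`. -/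
def realTorus : AlgGroup ℝ (Fin 2 × Fin 4) where
  points R _ _ := (realTorusHom R).range
  closed := by
    obtain ⟨I, hI⟩ := group.closed
    let X : Matrix (Fin 2 × Fin 4) (Fin 2 × Fin 4) (Poly ℝ) :=
      Matrix.of fun i j => MvPolynomial.X (i, j)
    refine ⟨(MvPolynomial.map (algebraMap ℤ ℝ)) '' I ∪
      {p | ∃ a b, a ≠ b ∧ p = iota (Poly ℝ) (algebraMap ℝ (Poly ℝ) √3)
        (algebraMap_sqrt_three_sq (Poly ℝ)) (extract X) a b}, fun R _ _ g => ?_⟩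
    let f : Poly ℝ →ₐ[ℝ] R :=
      MvPolynomial.aeval (fun ij : (Fin 2 × Fin 4) × (Fin 2 × Fin 4) => g ij.1 ij.2)
    have hX : X.map (f : Poly ℝ →+* R) = (g : Matrix (Fin 2 × Fin 4) (Fin 2 × Fin 4) R) := by
      ext i j
      simp [X, f]
    have h1 : iota R (algebraMap ℝ R √3) (algebraMap_sqrt_three_sq R)
        (extract (g : Matrix (Fin 2 × Fin 4) (Fin 2 × Fin 4) R)) =
        (iota (Poly ℝ) (algebraMap ℝ (Poly ℝ) √3) (algebraMap_sqrt_three_sq (Poly ℝ))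
          (extract X)).map (f : Poly ℝ →+* R) := by
      rw [← hX, extract_map]
      exact iota_map (f : Poly ℝ →+* R) (f : Poly ℝ →+* R) (fun _ => rfl) _ _ _ _
        (f.commutes _) _
    rw [mem_range_realTorusHom, h1]
    have h2 := hI R g
    change g ∈ normOne R ↔ _ at h2
    rw [h2]
    constructor
    · rintro ⟨ha, hb⟩ p (⟨q, hq, rfl⟩ | ⟨a, b, hab, rfl⟩)
      · rw [MvPolynomial.aeval_map_algebraMap]
        exact ha q hq
      · exact hb a b hab
    · intro h
      refine ⟨fun q hq => ?_, fun a b hab => h _ (Or.inr ⟨a, b, hab, rfl⟩)⟩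
      have := h _ (Or.inl ⟨q, hq, rfl⟩)
      rwa [MvPolynomial.aeval_map_algebraMap] at this

lemma realTorus_isSplitTorusOfDim : realTorus.IsSplitTorusOfDim 3 := by
  refine ⟨fun R _ _ => MonoidHom.ofInjective (realTorusHom_injective R),
    fun R R' _ _ _ _ f t => ?_⟩
  apply Units.ext
  change (realTorusHom R t : Matrix (Fin 2 × Fin 4) (Fin 2 × Fin 4) R).map (f : R →+* R') =
    (realTorusHom R' (fun i => Units.map (f : R →* R') (t i)) :
      Matrix (Fin 2 × Fin 4) (Fin 2 × Fin 4) R')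
  rw [realTorusHom_coe, realTorusHom_coe, ← leftMul_map]
  congr 1
  apply iota_injective (algebraMap ℝ R' √3) (algebraMap_sqrt_three_sq R') _ (algebraMap_sixth R')
  rw [iota_iotaInv _ _ _ (algebraMap_sixth R'),
    iota_map (f : R →+* R') (f : R →+* R') (fun _ => rfl) (algebraMap ℝ R √3)
      (algebraMap_sqrt_three_sq R) _ _ (f.commutes _),
    iota_iotaInv _ _ _ (algebraMap_sixth R), slDiag_coe, slDiag_coe,
    Matrix.diagonal_map (map_zero _)]
  congr 1
  funext i
  fin_cases i
  · rfl
  · rfl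
  · rfl
  · change ((Units.map (f : R →* R') (t 0 * t 1 * t 2)⁻¹ : R'ˣ) : R') = _
    simp

/-- The `ℝ`-rank of `G` is three. -/
lemma hasSplitRank_real : HasSplitRank ℝ group 3 := by
  refine ⟨⟨realTorus, ?_, realTorus_isSplitTorusOfDim⟩, ?_⟩
  · rintro R _ _ _ ⟨t, rfl⟩
    exact ((pointsEquiv R).symm (slDiag R t)).2
  · rintro r ⟨T, hT, φ, hφ⟩
    obtain ⟨W, x, h1, h2, h3, h4, h5⟩ := exists_weights_group hT φ hφ
    have h6 := succ_le_of_card_weights_le hT (φ ℝ) h3 (fun t => by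
      rw [h5]; simp)
    have hinj := iota_injective √3 sqrt_three_sq (1 / 6) (by norm_num)
    -- After splitting, the weight idempotents live in M₄(ℝ), so there are at most four of them.
    have h7 := card_le_of_orthogonal_idempotents W (fun χ => iota ℝ √3 sqrt_three_sq (x χ))
      (fun χ hχ => by
        rw [Ne, map_eq_zero_iff _ hinj]; exact (h4 χ).1 hχ)
      (fun χ => by rw [← map_mul, h1]) (fun χ ψ h => by rw [← map_mul, h2 χ ψ h, map_zero])
    rw [Fintype.card_fin] at h7
    omega

end RealRank

end QuatForm

/-! ### A real torus with compact orbits -/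

namespace QuatForm

open AlgGroup

section Orbit

/-- Because of this, the conjugating unit in `conjTorus` need not have reduced norm one. -/
lemma nrd_conj {R : Type} [CommRing R] (w x : (Matrix (Fin 2) (Fin 2) (Quat R))ˣ) :
    nrd R ((w * x * w⁻¹ : (Matrix (Fin 2) (Fin 2) (Quat R))ˣ) :
      Matrix (Fin 2) (Fin 2) (Quat R)) = nrd R x := by
  rw [Units.val_mul, Units.val_mul, map_mul, map_mul, mul_right_comm, ← map_mul, Units.mul_inv,
    map_one, one_mul]

/-- The conjugate by `w` of the torus `diag(s, s⁻¹)`. -/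
def conjTorus (w : (Matrix (Fin 2) (Fin 2) (Quat ℝ))ˣ) : ℝˣ →* group.points ℝ where
  toFun s := ⟨leftMulUnits ℝ (w * diagUnits ℝ s * w⁻¹), by
    change _ ∈ normOne ℝ
    rw [leftMulUnits_mem_normOne_iff, nrd_conj, ← leftMulUnits_mem_normOne_iff]
    exact leftMulUnits_diagUnits_mem s⟩
  map_one' := by
    apply Subtype.ext
    change leftMulUnits ℝ (w * diagUnits ℝ 1 * w⁻¹) = 1
    rw [map_one, mul_one, mul_inv_cancel, map_one]
  map_mul' s t := by
    apply Subtype.ext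
    change leftMulUnits ℝ (w * diagUnits ℝ (s * t) * w⁻¹) =
      leftMulUnits ℝ (w * diagUnits ℝ s * w⁻¹) * leftMulUnits ℝ (w * diagUnits ℝ t * w⁻¹)
    rw [← map_mul, map_mul (diagUnits ℝ)]
    congr 1
    group

lemma conjTorus_coe (w : (Matrix (Fin 2) (Fin 2) (Quat ℝ))ˣ) (s : ℝˣ) :
    ((conjTorus w s : GL (Fin 2 × Fin 4) ℝ) : Matrix (Fin 2 × Fin 4) (Fin 2 × Fin 4) ℝ) =
      leftMul ℝ (w * Matrix.diagonal ![algebraMap ℝ (Quat ℝ) s, algebraMap ℝ (Quat ℝ) ↑s⁻¹] *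
        ((w⁻¹ : (Matrix (Fin 2) (Fin 2) (Quat ℝ))ˣ) : Matrix (Fin 2) (Fin 2) (Quat ℝ))) := rfl

/-- The units `exp x` of `ℝ`. -/
def expUnit (x : ℝ) : ℝˣ := Units.mk0 (Real.exp x) (Real.exp_ne_zero x)

lemma continuous_expUnit : Continuous expUnit := by
  refine Units.continuous_iff.2 ⟨Real.continuous_exp, ?_⟩
  change Continuous fun x => (Real.exp x)⁻¹
  exact Real.continuous_exp.inv₀ Real.exp_ne_zero

lemma continuous_conjTorus_expUnit (w : (Matrix (Fin 2) (Fin 2) (Quat ℝ))ˣ) :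
    Continuous fun x => conjTorus w (expUnit x) := by
  have h : ∀ w : (Matrix (Fin 2) (Fin 2) (Quat ℝ))ˣ, Continuous fun s : ℝˣ =>
      leftMul ℝ (w * Matrix.diagonal ![algebraMap ℝ (Quat ℝ) s, algebraMap ℝ (Quat ℝ) ↑s⁻¹] *
        ((w⁻¹ : (Matrix (Fin 2) (Fin 2) (Quat ℝ))ˣ) : Matrix (Fin 2) (Fin 2) (Quat ℝ))) := by
    intro w
    simp only [map_mul, finTwo_diagonal_algebraMap]
    refine (continuous_const.mul (Continuous.matrix_diagonal (continuous_pi fun pa => ?_))).mul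
      continuous_const
    split_ifs
    · exact Units.continuous_val
    · exact Units.continuous_coe_inv
  refine Continuous.subtype_mk ?_ _
  refine Units.continuous_iff.2 ⟨(h w).comp continuous_expUnit, ?_⟩
  have h2 : (fun x => ((((conjTorus w (expUnit x) : GL (Fin 2 × Fin 4) ℝ))⁻¹ :
      GL (Fin 2 × Fin 4) ℝ) : Matrix (Fin 2 × Fin 4) (Fin 2 × Fin 4) ℝ)) =
      fun x => ((conjTorus w (expUnit (-x)) : GL (Fin 2 × Fin 4) ℝ) :
        Matrix (Fin 2 × Fin 4) (Fin 2 × Fin 4) ℝ) := by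
    funext x
    have h3 : expUnit (-x) = (expUnit x)⁻¹ := by
      apply Units.ext
      change Real.exp (-x) = (Real.exp x)⁻¹
      exact Real.exp_neg x
    rw [h3, map_inv]
    rfl
  exact h2 ▸ ((h w).comp (continuous_expUnit.comp continuous_neg))

/-- The basis of `ℝ²` of eigenvectors of the hyperbolic matrix `(2 3; 1 2)`. -/
def hypBasis : (Matrix (Fin 2) (Fin 2) ℝ)ˣ where
  -- The columns are √3/6 · (√3, 1) and (-√3, 1), eigenvectors for 2 + √3 and 2 - √3, scaled to give
  -- determinant one.
  val := !![1 / 2, -√3; √3 / 6, 1]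
  inv := !![1, √3; -√3 / 6, 1 / 2]
  val_inv := by
    ext i j
    fin_cases i <;> fin_cases j <;> simp [Matrix.mul_apply, Fin.sum_univ_two]
    · linear_combination sqrt_three_sq / 6
    · ring
    · ring
    · linear_combination sqrt_three_sq / 6
  inv_val := by
    ext i j
    fin_cases i <;> fin_cases j <;> simp [Matrix.mul_apply, Fin.sum_univ_two]
    · linear_combination sqrt_three_sq / 6
    · ring
    · linear_combination sqrt_three_sq / 6

/-- `hypBasis` as a quaternion matrix. -/
def hypUnit : (Matrix (Fin 2) (Fin 2) (Quat ℝ))ˣ :=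
  Units.map (algebraMap ℝ (Quat ℝ)).mapMatrix.toMonoidHom hypBasis

/-- A maximal split torus of `G` over `ℝ` with a cocompact lattice in `Γ`. -/
abbrev hypTorus : ℝˣ →* group.points ℝ := conjTorus hypUnit

/-- With these explicit entries, s = 2 + √3 visibly gives the integral matrix (2 3; 1 2). -/
lemma hypUnit_conj (s : ℝˣ) :
    (hypUnit : Matrix (Fin 2) (Fin 2) (Quat ℝ)) *
        Matrix.diagonal ![algebraMap ℝ (Quat ℝ) s, algebraMap ℝ (Quat ℝ) ↑s⁻¹] *
        ((hypUnit⁻¹ : (Matrix (Fin 2) (Fin 2) (Quat ℝ))ˣ) : Matrix (Fin 2) (Fin 2) (Quat ℝ)) =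
      (!![((s : ℝ) + (s : ℝ)⁻¹) / 2, √3 * ((s : ℝ) - (s : ℝ)⁻¹) / 2;
        √3 * ((s : ℝ) - (s : ℝ)⁻¹) / 6, ((s : ℝ) + (s : ℝ)⁻¹) / 2] :
        Matrix (Fin 2) (Fin 2) ℝ).map (algebraMap ℝ (Quat ℝ)) := by
  have hd : Matrix.diagonal ![algebraMap ℝ (Quat ℝ) s, algebraMap ℝ (Quat ℝ) ↑s⁻¹] =
      (algebraMap ℝ (Quat ℝ)).mapMatrix (Matrix.diagonal ![(s : ℝ), (s : ℝ)⁻¹]) := by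
    ext1 i j
    fin_cases i <;> fin_cases j <;> simp
  have hw : (hypUnit : Matrix (Fin 2) (Fin 2) (Quat ℝ)) =
      (algebraMap ℝ (Quat ℝ)).mapMatrix hypBasis.val := rfl
  have hw' : ((hypUnit⁻¹ : (Matrix (Fin 2) (Fin 2) (Quat ℝ))ˣ) : Matrix (Fin 2) (Fin 2) (Quat ℝ)) =
      (algebraMap ℝ (Quat ℝ)).mapMatrix hypBasis.inv := rfl
  rw [hd, hw, hw', ← map_mul, ← map_mul, RingHom.mapMatrix_apply]
  congr 1
  ext i j
  rw [Matrix.mul_apply, Fin.sum_univ_two, Matrix.mul_diagonal, Matrix.mul_diagonal]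
  fin_cases i <;> fin_cases j <;> simp [hypBasis]
  · linear_combination ((s : ℝ)⁻¹ / 6) * sqrt_three_sq
  · ring
  · ring
  · linear_combination ((s : ℝ) / 6) * sqrt_three_sq

/-- The fundamental unit `2 + √3`. -/
def fundUnit : ℝˣ :=
  ⟨2 + √3, 2 - √3, by linear_combination -sqrt_three_sq, by linear_combination -sqrt_three_sq⟩

lemma mem_arith_iff (g : group.points ℝ) :
    g ∈ group.arith ↔ ∃ N ∈ normOne ℤ,
      ((g : GL (Fin 2 × Fin 4) ℝ) : Matrix (Fin 2 × Fin 4) (Fin 2 × Fin 4) ℝ) =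
        (N : Matrix (Fin 2 × Fin 4) (Fin 2 × Fin 4) ℤ).map (Int.castRingHom ℝ) := by
  constructor
  · rintro ⟨N, hN, h⟩
    exact ⟨N, hN, (congrArg Units.val h).symm⟩
  · rintro ⟨N, hN, h⟩
    exact ⟨N, hN, Units.ext h.symm⟩

lemma hypTorus_fundUnit_mem : hypTorus fundUnit ∈ group.arith := by
  let γ : (Matrix (Fin 2) (Fin 2) (Quat ℤ))ˣ :=
    { val := !![2, 3; 1, 2]
      inv := !![2, -3; -1, 2]
      val_inv := by
        ext1 i j
        fin_cases i <;> fin_cases j <;> simp [Matrix.mul_apply, Fin.sum_univ_two] <;> norm_num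
      inv_val := by
        ext1 i j
        fin_cases i <;> fin_cases j <;> simp [Matrix.mul_apply, Fin.sum_univ_two] <;> norm_num }
  have h2 (n : ℕ) [n.AtLeastTwo] : quatMap (Int.castRingHom ℝ) (OfNat.ofNat n) = OfNat.ofNat n :=
    map_ofNat (quatMapHom (Int.castRingHom ℝ)) n
  have h1 : quatMap (Int.castRingHom ℝ) 1 = 1 := map_one (quatMapHom (Int.castRingHom ℝ))
  have hγ : γ.val.map (quatMap (Int.castRingHom ℝ)) =
      (hypUnit : Matrix (Fin 2) (Fin 2) (Quat ℝ)) * Matrix.diagonal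
        ![algebraMap ℝ (Quat ℝ) fundUnit, algebraMap ℝ (Quat ℝ) ↑fundUnit⁻¹] *
        ((hypUnit⁻¹ : (Matrix (Fin 2) (Fin 2) (Quat ℝ))ˣ) :
          Matrix (Fin 2) (Fin 2) (Quat ℝ)) := by
    have hs : (fundUnit : ℝ) = 2 + √3 := rfl
    have hs' : (fundUnit : ℝ)⁻¹ = 2 - √3 := by
      rw [← Units.val_inv_eq_inv_val]; rfl
    have e1 : (2 + √3 + (2 - √3)) / 2 = (2 : ℝ) := by ring
    have e2 : √3 * (2 + √3 - (2 - √3)) / 2 = (3 : ℝ) := by linear_combination sqrt_three_sq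
    have e3 : √3 * (2 + √3 - (2 - √3)) / 6 = (1 : ℝ) := by linear_combination sqrt_three_sq / 3
    rw [hypUnit_conj, hs', hs, e1, e2, e3]
    ext1 i j
    fin_cases i <;> fin_cases j <;> simp [γ, h1, h2]
  rw [mem_arith_iff]
  refine ⟨leftMulUnits ℤ γ, ?_, ?_⟩
  · rw [leftMulUnits_mem_normOne_iff]
    have h3 : nrd ℝ (γ.val.map (quatMap (Int.castRingHom ℝ))) = 1 := by
      rw [hγ]
      have := (leftMulUnits_mem_normOne_iff _).1 (hypTorus fundUnit).2
      exact this
    rw [nrd_map] at h3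
    -- The reduced norm over ℤ is recovered from the one over ℝ, since ℤ embeds in ℝ.
    have h4 := congrArg QuadraticAlgebra.re h3
    have h5 := congrArg QuadraticAlgebra.im h3
    have h6 : (((nrd ℤ γ).re : ℤ) : ℝ) = 1 := h4
    have h7 : (((nrd ℤ γ).im : ℤ) : ℝ) = 0 := h5
    ext
    · exact_mod_cast h6
    · exact_mod_cast h7
  · rw [conjTorus_coe, ← hγ, leftMul_map]
    rfl

/-- This handles the negative component of ℝˣ: the powers of 2 + √3 are cocompact only in the
positive reals, and -1 folds the other half onto it. -/
lemma hypTorus_neg_one_mem : hypTorus (-1) ∈ group.arith := by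
  rw [mem_arith_iff]
  have h1 : leftMulUnits ℤ (-1) ∈ normOne ℤ := by
    rw [leftMulUnits_mem_normOne_iff]
    have : ((-1 : (Matrix (Fin 2) (Fin 2) (Quat ℤ))ˣ) : Matrix (Fin 2) (Fin 2) (Quat ℤ)) =
        algebraMap ℤ _ (-1) := by simp
    rw [this, nrd_algebraMap]
    simp
  refine ⟨_, h1, ?_⟩
  have h2 : Matrix.diagonal ![algebraMap ℝ (Quat ℝ) ((-1 : ℝˣ) : ℝ),
      algebraMap ℝ (Quat ℝ) (((-1 : ℝˣ)⁻¹ : ℝˣ) : ℝ)] = -1 := by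
    ext1 i j
    fin_cases i <;> fin_cases j <;> simp
  rw [conjTorus_coe, h2, mul_neg, mul_one, neg_mul, Units.mul_inv, map_neg, map_one]
  change _ = (leftMul ℤ (-1)).map _
  rw [map_neg, map_one]
  ext i j
  by_cases hij : i = j <;> simp [hij]

lemma one_lt_fundUnit : (1 : ℝ) < fundUnit := by
  change (1 : ℝ) < 2 + √3
  have := Real.sqrt_nonneg 3
  linarith

/-- Modulo `Γ`, the torus is the image of a compact interval. -/
lemma exists_mem_Icc_hypTorus (s : ℝˣ) :
    ∃ x ∈ Set.Icc 0 (Real.log fundUnit),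
      (hypTorus (expUnit x))⁻¹ * hypTorus s ∈ group.arith := by
  have hs : (0 : ℝ) < |(s : ℝ)| := abs_pos.2 s.ne_zero
  -- Dividing |s| by a suitable power of 2 + √3 brings it between 1 and 2 + √3.
  obtain ⟨k, hk1, hk2⟩ := exists_mem_Ico_zpow hs one_lt_fundUnit
  have he : (0 : ℝ) < fundUnit := by linarith [one_lt_fundUnit]
  have hek : (0 : ℝ) < (fundUnit : ℝ) ^ k := zpow_pos he k
  have h1 : 1 ≤ |(s : ℝ)| / (fundUnit : ℝ) ^ k := by rwa [le_div_iff₀ hek, one_mul]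
  have h2 : |(s : ℝ)| / (fundUnit : ℝ) ^ k ≤ fundUnit := by
    rw [div_le_iff₀ hek, ← zpow_one_add₀ he.ne', add_comm]
    exact hk2.le
  have hpos : 0 < |(s : ℝ)| / (fundUnit : ℝ) ^ k := by linarith
  refine ⟨Real.log (|(s : ℝ)| / (fundUnit : ℝ) ^ k), ⟨Real.log_nonneg h1,
    Real.log_le_log hpos h2⟩, ?_⟩
  set e := expUnit (Real.log (|(s : ℝ)| / (fundUnit : ℝ) ^ k)) with hedef
  have hev : (e : ℝ) = |(s : ℝ)| / (fundUnit : ℝ) ^ k := Real.exp_log hpos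
  have hpow : hypTorus (fundUnit ^ k) ∈ group.arith := by
    rw [map_zpow]; exact Subgroup.zpow_mem _ hypTorus_fundUnit_mem k
  rcases abs_choice (s : ℝ) with h | h
  · have : s = e * fundUnit ^ k := by
      apply Units.ext
      rw [Units.val_mul, hev, h, Units.val_zpow_eq_zpow_val, div_mul_cancel₀ _ hek.ne']
    rw [this, map_mul, inv_mul_cancel_left]
    exact hpow
  · have : s = e * (-1 * fundUnit ^ k) := by
      apply Units.ext
      rw [Units.val_mul, Units.val_mul, hev, h, Units.val_zpow_eq_zpow_val, Units.val_neg,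
        Units.val_one, neg_one_mul, mul_neg, div_mul_cancel₀ _ hek.ne', neg_neg]
    rw [this, map_mul, map_mul, inv_mul_cancel_left]
    exact Subgroup.mul_mem _ hypTorus_neg_one_mem hpow

/-- Modulo Γ the torus is covered by one period of logarithms, so the set is a continuous image of a
compact interval. -/
lemma isCompact_hypTorus_orbit (h : group.points ℝ) :
    IsCompact {y : group.points ℝ ⧸ group.arith |
      ∃ s : ℝˣ, y = QuotientGroup.mk (h * hypTorus s)} := by
  have : {y : group.points ℝ ⧸ group.arith | ∃ s : ℝˣ, y = QuotientGroup.mk (h * hypTorus s)} =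
      (fun x : ℝ => (QuotientGroup.mk (h * hypTorus (expUnit x)) :
        group.points ℝ ⧸ group.arith)) '' Set.Icc 0 (Real.log fundUnit) := by
    ext y
    constructor
    · rintro ⟨s, rfl⟩
      obtain ⟨x, hx, hxs⟩ := exists_mem_Icc_hypTorus s
      refine ⟨x, hx, QuotientGroup.eq.2 ?_⟩
      rw [mul_inv_rev, mul_assoc, inv_mul_cancel_left]
      exact hxs
    · rintro ⟨x, _, rfl⟩
      exact ⟨_, rfl⟩
  rw [this]
  refine isCompact_Icc.image ?_
  exact QuotientGroup.continuous_mk.comp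
    (continuous_const.mul (continuous_conjTorus_expUnit hypUnit))

end Orbit

end QuatForm

/-! ### Pushing the compact orbit out of compact sets -/

namespace QuatForm

open AlgGroup

section Divergence

/-- The quaternion `j`. -/
def quatJ (R : Type) [CommRing R] : Quat R := ⟨0, 0, 1, 0⟩

/-- The basis of `B²` of eigenvectors, over `B`, of the hyperbolic matrix `(2 3; 1 2)`. -/
def quatBasis : (Matrix (Fin 2) (Fin 2) (Quat ℝ))ˣ where
  -- Since j² = 3, the columns (j, 1) and (-j, 1) are eigenvectors of (2 3; 1 2) with right
  -- eigenvalues 2 + j and 2 - j.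
  val := !![quatJ ℝ, -quatJ ℝ; 1, 1]
  inv := !![⟨0, 0, 1 / 6, 0⟩, ⟨1 / 2, 0, 0, 0⟩; ⟨0, 0, -1 / 6, 0⟩, ⟨1 / 2, 0, 0, 0⟩]
  val_inv := by
    ext1 i j
    fin_cases i <;> fin_cases j <;> simp <;> ext <;> simp [quatJ] <;> norm_num
  inv_val := by
    ext1 i j
    fin_cases i <;> fin_cases j <;> simp <;> ext <;> simp [quatJ] <;> norm_num

/-- The matrix with first column the eigenvector `(j, 1)`. -/
def eigenMat (R : Type) [CommRing R] : Matrix (Fin 2) (Fin 2) (Quat R) := !![quatJ R, 0; 1, 0]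

/-- The torus `hypTorus` preserves the `B`-line spanned by `(j, 1)`. -/
lemma hypTorus_mul_eigenMat (s : ℝˣ) :
    ∃ Q : Matrix (Fin 2) (Fin 2) (Quat ℝ),
      ((hypTorus s : GL (Fin 2 × Fin 4) ℝ) : Matrix (Fin 2 × Fin 4) (Fin 2 × Fin 4) ℝ) *
        leftMul ℝ (eigenMat ℝ) = leftMul ℝ (eigenMat ℝ) * leftMul ℝ Q := by
  -- Here j plays the role of √3: the first diagonal entry of Q is the right eigenvalue on (j, 1),
  -- equal to 2 + j at s = 2 + √3.
  refine ⟨Matrix.diagonal ![⟨((s : ℝ) + (s : ℝ)⁻¹) / 2, 0, √3 * ((s : ℝ) - (s : ℝ)⁻¹) / 6, 0⟩, 0],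
    ?_⟩
  rw [conjTorus_coe, hypUnit_conj, ← map_mul, ← map_mul]
  congr 1
  ext1 i j
  rw [Matrix.mul_diagonal, Matrix.mul_apply, Fin.sum_univ_two]
  fin_cases i <;> fin_cases j <;> simp [eigenMat] <;> ext <;> simp [quatJ]
  ring

/-- The torus `conjTorus quatBasis` scales the `B`-line spanned by `(j, 1)`. -/
lemma conjTorus_quatBasis_mul_eigenMat (μ : ℝˣ) :
    ((conjTorus quatBasis μ : GL (Fin 2 × Fin 4) ℝ) :
        Matrix (Fin 2 × Fin 4) (Fin 2 × Fin 4) ℝ) * leftMul ℝ (eigenMat ℝ) =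
      (μ : ℝ) • leftMul ℝ (eigenMat ℝ) := by
  have h1 : quatBasis.inv * eigenMat ℝ = Matrix.diagonal ![1, 0] := by
    ext1 i j
    fin_cases i <;> fin_cases j <;> simp [quatBasis, eigenMat] <;> ext <;> simp [quatJ] <;> norm_num
  have h2 : quatBasis.val * Matrix.diagonal ![1, 0] = eigenMat ℝ := by
    ext1 i j
    rw [Matrix.mul_diagonal]
    fin_cases i <;> fin_cases j <;> simp [quatBasis, eigenMat]
  rw [conjTorus_coe, ← map_mul, ← map_smul]
  congr 1
  rw [mul_assoc]
  change quatBasis.val * _ * (quatBasis.inv * _) = _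
  rw [h1, mul_assoc]
  have h3 : Matrix.diagonal ![algebraMap ℝ (Quat ℝ) μ, algebraMap ℝ (Quat ℝ) ↑μ⁻¹] *
      Matrix.diagonal ![1, 0] = (μ : ℝ) • (Matrix.diagonal ![1, 0] :
        Matrix (Fin 2) (Fin 2) (Quat ℝ)) := by
    ext1 i j
    rw [Matrix.mul_diagonal]
    fin_cases i <;> fin_cases j <;> simp [Algebra.algebraMap_eq_smul_one]
  rw [h3, Matrix.mul_smul, h2]

/-- A nonzero lattice vector is not contracted by an element of `Γ`. -/
lemma exists_one_le_of_mem_arith {γ : group.points ℝ} (hγ : γ ∈ group.arith) :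
    ∃ i j, 1 ≤ |(((γ : GL (Fin 2 × Fin 4) ℝ) : Matrix (Fin 2 × Fin 4) (Fin 2 × Fin 4) ℝ) *
      leftMul ℝ (eigenMat ℝ)) i j| := by
  obtain ⟨N, -, hN⟩ := (mem_arith_iff γ).1 hγ
  have hE : eigenMat ℝ = (eigenMat ℤ).map (quatMap (Int.castRingHom ℝ)) := by
    ext1 i j
    fin_cases i <;> fin_cases j <;> ext <;> simp [eigenMat, quatJ, quatMap]
  -- The line has an integral generator and N is invertible, so the product is a nonzero integer
  -- matrix and has an entry of absolute value at least 1.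
  have hne : (N : Matrix (Fin 2 × Fin 4) (Fin 2 × Fin 4) ℤ) * leftMul ℤ (eigenMat ℤ) ≠ 0 := by
    intro h
    have h1 : leftMul ℤ (eigenMat ℤ) = 0 := by
      rw [← Units.inv_mul_cancel_left N (leftMul ℤ (eigenMat ℤ)), h, mul_zero]
    have h2 := (map_eq_zero_iff _ (leftMul_injective ℤ)).1 h1
    have h3 := congrFun (congrFun h2 1) 0
    simp [eigenMat] at h3
  obtain ⟨i, j, hij⟩ : ∃ i j,
      ((N : Matrix (Fin 2 × Fin 4) (Fin 2 × Fin 4) ℤ) * leftMul ℤ (eigenMat ℤ)) i j ≠ 0 := by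
    by_contra! h; exact hne (Matrix.ext h)
  refine ⟨i, j, ?_⟩
  rw [hN, hE, leftMul_map, ← Matrix.map_mul, Matrix.map_apply]
  rw [eq_intCast, ← Int.cast_abs]
  exact_mod_cast Int.one_le_abs hij

/-- A compact subset of `G / Γ` is the image of a set of matrices with bounded inverses. -/
lemma exists_bound_of_isCompact {K : Set (group.points ℝ ⧸ group.arith)} (hK : IsCompact K) :
    ∃ n : ℕ, ∀ y ∈ K, ∃ g : group.points ℝ, QuotientGroup.mk g = y ∧
      ∀ i j, |(((g⁻¹ : group.points ℝ) : GL (Fin 2 × Fin 4) ℝ) :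
        Matrix (Fin 2 × Fin 4) (Fin 2 × Fin 4) ℝ) i j| < n := by
  let U : ℕ → Set (group.points ℝ) := fun n => {g | ∀ i j,
    |(((g⁻¹ : group.points ℝ) : GL (Fin 2 × Fin 4) ℝ) :
      Matrix (Fin 2 × Fin 4) (Fin 2 × Fin 4) ℝ) i j| < n}
  have hU : ∀ n, IsOpen (U n) := by
    intro n
    have : U n = ⋂ i, ⋂ j, {g | |(((g⁻¹ : group.points ℝ) : GL (Fin 2 × Fin 4) ℝ) :
        Matrix (Fin 2 × Fin 4) (Fin 2 × Fin 4) ℝ) i j| < n} := by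
      ext g; simp [U]
    rw [this]
    refine isOpen_iInter_of_finite fun i => isOpen_iInter_of_finite fun j =>
      isOpen_lt ?_ continuous_const
    have hc : Continuous fun g : group.points ℝ => (((g⁻¹ : group.points ℝ) :
        GL (Fin 2 × Fin 4) ℝ) : Matrix (Fin 2 × Fin 4) (Fin 2 × Fin 4) ℝ) :=
      Units.continuous_val.comp (continuous_subtype_val.comp continuous_inv)
    exact (hc.matrix_elem i j).abs
  have hmono : Monotone U := fun m n hmn g hg i j =>
    (hg i j).trans_le (by exact_mod_cast hmn)
  -- The sets U n increase to the whole group and the quotient map is open, so a single image covers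
  -- K.
  obtain ⟨n, hn⟩ := hK.elim_directed_cover
    (fun n => (QuotientGroup.mk '' U n : Set (group.points ℝ ⧸ group.arith)))
    (fun n => QuotientGroup.isOpenMap_coe _ (hU n))
    (fun y _ => by
      obtain ⟨g, rfl⟩ := QuotientGroup.mk_surjective y
      obtain ⟨n, hn⟩ := exists_nat_gt (∑ i, ∑ j, |(((g⁻¹ : group.points ℝ) :
        GL (Fin 2 × Fin 4) ℝ) : Matrix (Fin 2 × Fin 4) (Fin 2 × Fin 4) ℝ) i j|)
      refine Set.mem_iUnion.2 ⟨n, g, fun i j => lt_of_le_of_lt ?_ hn, rfl⟩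
      refine (Finset.single_le_sum (f := fun j => |(((g⁻¹ : group.points ℝ) :
        GL (Fin 2 × Fin 4) ℝ) : Matrix (Fin 2 × Fin 4) (Fin 2 × Fin 4) ℝ) i j|)
        (fun _ _ => abs_nonneg _) (Finset.mem_univ j)).trans ?_
      exact Finset.single_le_sum (f := fun i => ∑ j, |(((g⁻¹ : group.points ℝ) :
        GL (Fin 2 × Fin 4) ℝ) : Matrix (Fin 2 × Fin 4) (Fin 2 × Fin 4) ℝ) i j|)
        (fun _ _ => Finset.sum_nonneg fun _ _ => abs_nonneg _) (Finset.mem_univ i))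
    (fun m n => ⟨max m n, Set.image_mono (hmono (le_max_left m n)),
      Set.image_mono (hmono (le_max_right m n))⟩)
  refine ⟨n, fun y hy => ?_⟩
  obtain ⟨g, hg, rfl⟩ := hn hy
  exact ⟨g, rfl, hg⟩

/-- The orbit of the torus `hypTorus` can be pushed out of any compact set. -/
lemma exists_forall_notMem {K : Set (group.points ℝ ⧸ group.arith)} (hK : IsCompact K) :
    ∃ a : group.points ℝ, ∀ s : ℝˣ,
      (QuotientGroup.mk (a * hypTorus s) : group.points ℝ ⧸ group.arith) ∉ K := by
  obtain ⟨n, hn⟩ := exists_bound_of_isCompact hK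
  let A : ℝ → Matrix (Fin 2 × Fin 4) (Fin 2 × Fin 4) ℝ := fun x =>
    ((hypTorus (expUnit x) : GL (Fin 2 × Fin 4) ℝ) :
      Matrix (Fin 2 × Fin 4) (Fin 2 × Fin 4) ℝ) * leftMul ℝ (eigenMat ℝ)
  have hA : Continuous A := (Units.continuous_val.comp (continuous_subtype_val.comp
    (continuous_conjTorus_expUnit hypUnit))).mul continuous_const
  -- The bound M controls the images of the eigenvector matrix over one period of the torus.
  obtain ⟨M, hM⟩ := (isCompact_Icc (a := (0 : ℝ)) (b := Real.log fundUnit)).bddAbove_image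
    (f := fun x => ∑ k, ∑ j, |A x k j|)
    (continuous_finsetSum _ fun k _ => continuous_finsetSum _ fun j _ =>
      (hA.matrix_elem k j).abs).continuousOn
  have hM' : ∀ x ∈ Set.Icc 0 (Real.log fundUnit), ∀ j, ∑ k, |A x k j| ≤ M := by
    intro x hx j
    refine le_trans ?_ (hM ⟨x, hx, rfl⟩)
    exact Finset.sum_le_sum fun k _ => Finset.single_le_sum (f := fun j => |A x k j|)
      (fun _ _ => abs_nonneg _) (Finset.mem_univ j)
  have hM0 : 0 ≤ M := by
    refine le_trans (Finset.sum_nonneg fun k _ => abs_nonneg (A 0 k (0, 0))) (hM' 0 ⟨le_rfl, ?_⟩ _)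
    exact Real.log_nonneg one_lt_fundUnit.le
  have hpos : 0 < (n : ℝ) * M + 1 := by positivity
  -- The factor is chosen so that μ · nM < 1.
  let μ : ℝˣ := Units.mk0 (((n : ℝ) * M + 1)⁻¹) (inv_ne_zero hpos.ne')
  refine ⟨conjTorus quatBasis μ, fun s hs => ?_⟩
  obtain ⟨x, hx, hxs⟩ := exists_mem_Icc_hypTorus s
  have hxK : (QuotientGroup.mk (conjTorus quatBasis μ * hypTorus (expUnit x)) :
      group.points ℝ ⧸ group.arith) ∈ K := by
    have : (QuotientGroup.mk (conjTorus quatBasis μ * hypTorus (expUnit x)) :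
        group.points ℝ ⧸ group.arith) =
        QuotientGroup.mk (conjTorus quatBasis μ * hypTorus s) := by
      refine QuotientGroup.eq.2 ?_
      rw [mul_inv_rev, mul_assoc, inv_mul_cancel_left]
      exact hxs
    rw [this]
    exact hs
  -- If the translate met K, then g⁻¹ · a · A(x) would lie in Γ with the entries of g⁻¹ below n.
  -- Applied to the eigenvector matrix it would produce an entry of absolute value at least 1,
  -- whereas all its entries are at most μ · nM.
  obtain ⟨g, hg, hgn⟩ := hn _ hxK
  obtain ⟨i, j, hij⟩ := exists_one_le_of_mem_arith (QuotientGroup.eq.1 hg)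
  obtain ⟨Q, hQ⟩ := hypTorus_mul_eigenMat (expUnit x)
  let B : Matrix (Fin 2 × Fin 4) (Fin 2 × Fin 4) ℝ :=
    (((g⁻¹ : group.points ℝ) : GL (Fin 2 × Fin 4) ℝ) : Matrix (Fin 2 × Fin 4) (Fin 2 × Fin 4) ℝ)
  have hprod : ((((g⁻¹ * (conjTorus quatBasis μ * hypTorus (expUnit x)) : group.points ℝ) :
      GL (Fin 2 × Fin 4) ℝ)) : Matrix (Fin 2 × Fin 4) (Fin 2 × Fin 4) ℝ) *
      leftMul ℝ (eigenMat ℝ) = (μ : ℝ) • (B * A x) := by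
    change B * (((conjTorus quatBasis μ : GL (Fin 2 × Fin 4) ℝ) :
        Matrix (Fin 2 × Fin 4) (Fin 2 × Fin 4) ℝ) *
        ((hypTorus (expUnit x) : GL (Fin 2 × Fin 4) ℝ) :
        Matrix (Fin 2 × Fin 4) (Fin 2 × Fin 4) ℝ)) * leftMul ℝ (eigenMat ℝ) = _
    have hA' : A x = leftMul ℝ (eigenMat ℝ) * leftMul ℝ Q := hQ
    -- The torus acts first but keeps the line, on which the second torus is the scalar μ; so μ can
    -- be pulled out.
    rw [mul_assoc, mul_assoc, hQ, ← mul_assoc _ (leftMul ℝ (eigenMat ℝ)),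
      conjTorus_quatBasis_mul_eigenMat, hA', Matrix.smul_mul, Matrix.mul_smul]
  rw [hprod, Matrix.smul_apply, smul_eq_mul, abs_mul, Matrix.mul_apply] at hij
  have h1 : |∑ k, B i k * A x k j| ≤ n * M := by
    calc |∑ k, B i k * A x k j| ≤ ∑ k, |B i k * A x k j| := Finset.abs_sum_le_sum_abs _ _
      _ ≤ ∑ k, n * |A x k j| := Finset.sum_le_sum fun k _ => by
          rw [abs_mul]
          exact mul_le_mul_of_nonneg_right (hgn i k).le (abs_nonneg _)
      _ = n * ∑ k, |A x k j| := by rw [Finset.mul_sum]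
      _ ≤ n * M := mul_le_mul_of_nonneg_left (hM' x hx j) (Nat.cast_nonneg n)
  have hμ : |(μ : ℝ)| = ((n : ℝ) * M + 1)⁻¹ := abs_of_pos (inv_pos.2 hpos)
  rw [hμ, inv_mul_eq_div, le_div_iff₀ hpos, one_mul] at hij
  linarith

end Divergence

/-! ### Real points of maximal ℚ-split tori -/

section RationalTori

/-- Oddness gives roots of negative numbers. Hence a weight m loses no real points: S(ℝ) is the
whole conjugate torus. -/
lemma odd_zpow_surjective {m : ℤ} (hm : Odd m) (s : ℝˣ) : ∃ t : ℝˣ, t ^ m = s := by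
  have hm0 : (m : ℝ) ≠ 0 := by
    rintro h
    have : m = 0 := by exact_mod_cast h
    simp [this] at hm
  have hs : (0 : ℝ) < |(s : ℝ)| := abs_pos.2 s.ne_zero
  let e : ℝˣ := expUnit (Real.log |(s : ℝ)| / m)
  have he : ((e ^ m : ℝˣ) : ℝ) = |(s : ℝ)| := by
    rw [Units.val_zpow_eq_zpow_val]
    change Real.exp _ ^ m = _
    rw [← Real.rpow_intCast, ← Real.exp_mul, div_mul_cancel₀ _ hm0, Real.exp_log hs]
  rcases abs_choice (s : ℝ) with h | h
  · exact ⟨e, Units.ext (he.trans h)⟩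
  · refine ⟨-e, Units.ext ?_⟩
    rw [hm.neg_zpow, Units.val_neg, he, h, neg_neg]

/-- The real points of a one-dimensional split torus over `ℚ` in `G` are conjugate in `G` to
`hypTorus`. -/
lemma exists_conj_hypTorus {x : Matrix (Fin 2) (Fin 2) (Quat ℚ)} (hx : x * x = x) (hx0 : x ≠ 0)
    (hx1 : x ≠ 1) :
    ∃ h : group.points ℝ, ∀ s : ℝˣ,
      ((h * hypTorus s * h⁻¹ : group.points ℝ) : GL (Fin 2 × Fin 4) ℝ).1 =
        (s : ℝ) • (leftMul ℚ x).map (algebraMap ℚ ℝ) +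
          ((s⁻¹ : ℝˣ) : ℝ) • (leftMul ℚ (1 - x)).map (algebraMap ℚ ℝ) := by
  obtain ⟨u, v, huv, hvu, hu⟩ := exists_unit_conj_of_idempotent hx hx0 hx1
  let q : Matrix (Fin 2) (Fin 2) (Quat ℚ) →+* Matrix (Fin 2) (Fin 2) (Quat ℝ) :=
    (quatMapHom (algebraMap ℚ ℝ)).mapMatrix
  let ι := iota ℝ √3 sqrt_three_sq
  have hinj : Function.Injective ι := iota_injective √3 sqrt_three_sq (1 / 6) (by norm_num)
  set E : Matrix (Fin 2) (Fin 2) (Quat ℝ) := Matrix.diagonal ![1, 0] with hE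
  have hqE : q (Matrix.diagonal ![1, 0]) = E := by
    ext1 i j
    change quatMap (algebraMap ℚ ℝ) _ = _
    fin_cases i <;> fin_cases j <;> ext <;> simp [hE, quatMap]
  -- Conjugation by u w⁻¹ does the job but may have determinant different from one. The matrix
  -- diag(c, 1, 1, 1) commutes with the image diag(1, 1, 0, 0) of E, so inserting it corrects the
  -- determinant without affecting the conjugation.
  let C : ℝ → Matrix (Fin 4) (Fin 4) ℝ := fun c => Matrix.diagonal ![c, 1, 1, 1]
  have hCE : ∀ c, C c * ι E = ι E * C c := by
    intro c
    have hιE : ι E = Matrix.diagonal ![1, 1, 0, 0] := by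
      refine matrix_ext_blk fun p i q j => ?_
      rw [iota_blk, liftHom_eq]
      have e0 : blk 0 0 = 0 := rfl
      have e1 : blk 0 1 = 1 := rfl
      have e2 : blk 1 0 = 2 := rfl
      have e3 : blk 1 1 = 3 := rfl
      fin_cases p <;> fin_cases i <;> fin_cases q <;> fin_cases j <;>
        simp [e0, e1, e2, e3, hE]
    rw [hιE]
    simp only [C, Matrix.diagonal_mul_diagonal]
    congr 1
    funext i
    ring
  let w := hypUnit
  have hdet : (ι (q u)).det * (ι (w⁻¹ : (Matrix (Fin 2) (Fin 2) (Quat ℝ))ˣ)).det ≠ 0 := by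
    refine mul_ne_zero ?_ ?_
    · have h1 : (ι (q u)).det * (ι (q v)).det = 1 := by
        rw [← Matrix.det_mul, ← map_mul, ← map_mul, huv, map_one, map_one, Matrix.det_one]
      exact left_ne_zero_of_mul_eq_one h1
    · have h1 : (ι (w⁻¹ : (Matrix (Fin 2) (Fin 2) (Quat ℝ))ˣ)).det * (ι w).det = 1 := by
        rw [← Matrix.det_mul, ← map_mul, Units.inv_mul, map_one, Matrix.det_one]
      exact left_ne_zero_of_mul_eq_one h1
  let c : ℝ := ((ι (q u)).det * (ι (w⁻¹ : (Matrix (Fin 2) (Fin 2) (Quat ℝ))ˣ)).det)⁻¹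
  let M : Matrix.SpecialLinearGroup (Fin 4) ℝ :=
    ⟨ι (q u) * C c * ι (w⁻¹ : (Matrix (Fin 2) (Fin 2) (Quat ℝ))ˣ), by
      have hC : (C c).det = c := by
        simp [C, Matrix.det_diagonal, Fin.prod_univ_four]
      rw [Matrix.det_mul, Matrix.det_mul, hC, mul_right_comm]
      exact mul_inv_cancel₀ hdet⟩
  let e := normOneEquiv √3 sqrt_three_sq (1 / 6) (by norm_num)
  let h : group.points ℝ := e.symm M
  let H : Matrix (Fin 2) (Fin 2) (Quat ℝ) := iotaInv √3 (1 / 6) M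
  have hh : ((h : GL (Fin 2 × Fin 4) ℝ) : Matrix (Fin 2 × Fin 4) (Fin 2 × Fin 4) ℝ) =
      leftMul ℝ H := rfl
  have hιH : ι H = M.1 := iota_iotaInv √3 sqrt_three_sq (1 / 6) (by norm_num) M
  -- H carries the idempotent w E w⁻¹ of `hypTorus` to x, so it conjugates every combination of
  -- idempotent and complement accordingly.
  have hkey : q x * H = H * (w * E * (w⁻¹ : (Matrix (Fin 2) (Fin 2) (Quat ℝ))ˣ)) := by
    apply hinj
    have hw : ι (w⁻¹ : (Matrix (Fin 2) (Fin 2) (Quat ℝ))ˣ) * ι w = 1 := by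
      rw [← map_mul, Units.inv_mul, map_one]
    have hqxu : ι (q x) * ι (q u) = ι (q u) * ι E := by
      rw [← map_mul, ← map_mul, hu, map_mul, hqE, map_mul]
    rw [map_mul, map_mul, map_mul, map_mul, hιH]
    change ι (q x) * (ι (q u) * C c * ι (w⁻¹ : (Matrix (Fin 2) (Fin 2) (Quat ℝ))ˣ)) =
      ι (q u) * C c * ι (w⁻¹ : (Matrix (Fin 2) (Fin 2) (Quat ℝ))ˣ) *
        (ι w * ι E * ι (w⁻¹ : (Matrix (Fin 2) (Fin 2) (Quat ℝ))ˣ))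
    calc _ = ι (q x) * ι (q u) * C c * ι (w⁻¹ : (Matrix (Fin 2) (Fin 2) (Quat ℝ))ˣ) := by
          simp only [mul_assoc]
      _ = ι (q u) * (C c * ι E) * ι (w⁻¹ : (Matrix (Fin 2) (Fin 2) (Quat ℝ))ˣ) := by
          rw [hqxu, hCE]; simp only [mul_assoc]
      _ = ι (q u) * C c * (ι (w⁻¹ : (Matrix (Fin 2) (Fin 2) (Quat ℝ))ˣ) * ι w) * ι E *
          ι (w⁻¹ : (Matrix (Fin 2) (Fin 2) (Quat ℝ))ˣ) := by
          rw [hw]; simp only [mul_assoc, mul_one]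
      _ = _ := by simp only [mul_assoc]
  refine ⟨h, fun s => ?_⟩
  set y : Matrix (Fin 2) (Fin 2) (Quat ℝ) := (s : ℝ) • q x + ((s⁻¹ : ℝˣ) : ℝ) • (1 - q x) with hy
  have hrhs : (s : ℝ) • (leftMul ℚ x).map (algebraMap ℚ ℝ) +
      ((s⁻¹ : ℝˣ) : ℝ) • (leftMul ℚ (1 - x)).map (algebraMap ℚ ℝ) = leftMul ℝ y := by
    rw [← leftMul_map, ← leftMul_map, ← map_smul, ← map_smul, ← map_add, hy,
      ← map_one q, ← map_sub q]
    rfl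
  have hdiag : Matrix.diagonal ![algebraMap ℝ (Quat ℝ) s, algebraMap ℝ (Quat ℝ) ↑s⁻¹] =
      (s : ℝ) • E + ((s⁻¹ : ℝˣ) : ℝ) • (1 - E) := by
    ext1 i j
    fin_cases i <;> fin_cases j <;> simp [hE, Algebra.algebraMap_eq_smul_one]
  have hyH : leftMul ℝ y * leftMul ℝ H = leftMul ℝ H *
      ((hypTorus s : GL (Fin 2 × Fin 4) ℝ) : Matrix (Fin 2 × Fin 4) (Fin 2 × Fin 4) ℝ) := by
    rw [conjTorus_coe, ← map_mul, ← map_mul, hdiag]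
    congr 1
    change _ = H * (w * _ * (w⁻¹ : (Matrix (Fin 2) (Fin 2) (Quat ℝ))ˣ))
    rw [hy, add_mul, Matrix.smul_mul, Matrix.smul_mul, sub_mul, one_mul, hkey, mul_add, add_mul,
      mul_add, Matrix.mul_smul, Matrix.smul_mul, Matrix.mul_smul, Matrix.mul_smul, Matrix.smul_mul,
      Matrix.mul_smul, mul_sub, sub_mul, mul_sub, mul_one, Units.mul_inv, mul_one]
  rw [hrhs]
  have hinv : ((h : GL (Fin 2 × Fin 4) ℝ) : Matrix (Fin 2 × Fin 4) (Fin 2 × Fin 4) ℝ) *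
      (((h⁻¹ : group.points ℝ) : GL (Fin 2 × Fin 4) ℝ) :
        Matrix (Fin 2 × Fin 4) (Fin 2 × Fin 4) ℝ) = 1 :=
    Units.mul_inv (h : GL (Fin 2 × Fin 4) ℝ)
  change (((h : GL (Fin 2 × Fin 4) ℝ) : Matrix (Fin 2 × Fin 4) (Fin 2 × Fin 4) ℝ) *
    ((hypTorus s : GL (Fin 2 × Fin 4) ℝ) : Matrix (Fin 2 × Fin 4) (Fin 2 × Fin 4) ℝ)) *
    (((h⁻¹ : group.points ℝ) : GL (Fin 2 × Fin 4) ℝ) :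
        Matrix (Fin 2 × Fin 4) (Fin 2 × Fin 4) ℝ) = _
  rw [hh] at hinv ⊢
  rw [← hyH, mul_assoc, hinv, mul_one]

/-- The real points of every maximal split torus over `ℚ` of `G` are conjugate in `G` to
`hypTorus`. -/
lemma exists_conj_of_isMaximalSplitTorus {S : AlgGroup ℚ (Fin 2 × Fin 4)}
    (hS : IsMaximalSplitTorus ℚ group S) :
    ∃ h : group.points ℝ, ∀ g : group.points ℝ,
      (g : GL (Fin 2 × Fin 4) ℝ) ∈ S.points ℝ ↔ ∃ s : ℝˣ, g = h * hypTorus s * h⁻¹ := by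
  obtain ⟨⟨hSG, d, hd⟩, hmax⟩ := hS
  have hd1 := dim_le_one hSG hd
  obtain ⟨φ, hφ⟩ := hd
  interval_cases d
  -- A zero-dimensional S is trivial, hence properly contained in `torus` and not maximal.
  · exfalso
    have htriv : ∀ (R : Type) [CommRing R] [Algebra ℚ R] (g : GL (Fin 2 × Fin 4) R),
        g ∈ S.points R → g = 1 := by
      intro R _ _ g hg
      obtain ⟨t, ht⟩ := (φ R).surjective ⟨g, hg⟩
      rw [Subsingleton.elim t 1, map_one] at ht
      exact (congrArg Subtype.val ht).symm
    have hle := hmax torus torus_isSubgroupOver ⟨1, torus_isSplitTorusOfDim⟩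
      (fun R _ _ g hg => by rw [htriv R g hg]; exact Subgroup.one_mem _)
    have h1 := htriv ℚ _ (hle ℚ ⟨Units.mk0 2 two_ne_zero, rfl⟩)
    have h2 : (Units.mk0 2 two_ne_zero : ℚˣ) = 1 := diag_injective ℚ (by rw [map_one]; exact h1)
    have h3 : (2 : ℚ) = 1 := congrArg Units.val h2
    norm_num at h3
  · obtain ⟨x, m, hx, hx0, hx1, hm, hval⟩ := exists_idempotent_of_dim_one hSG φ hφ
    obtain ⟨h, hh⟩ := exists_conj_hypTorus hx hx0 hx1
    refine ⟨h, fun g => ⟨fun hg => ?_, ?_⟩⟩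
    · obtain ⟨t, ht⟩ := (φ ℝ).surjective ⟨g, hg⟩
      refine ⟨t 0 ^ m, Subtype.ext (Units.ext ?_)⟩
      rw [← congrArg Subtype.val ht]
      exact (hval ℝ t).trans (hh _).symm
    · rintro ⟨s, rfl⟩
      obtain ⟨t, rfl⟩ := odd_zpow_surjective hm s
      have : ((h * hypTorus (t ^ m) * h⁻¹ : group.points ℝ) : GL (Fin 2 × Fin 4) ℝ) =
          φ ℝ fun _ => t :=
        Units.ext ((hh _).trans (hval ℝ fun _ => t).symm)
      rw [this]
      exact (φ ℝ fun _ => t).2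

end RationalTori

end QuatForm

end

/-! ### Assembling the main theorem -/

theorem mainTheorem11 :
    QuatForm.group.IsSemisimple ∧
    (∃ e : QuatForm.group.points ℝ ≃ₜ* Matrix.SpecialLinearGroup (Fin 4) ℝ,
      ∀ (u : (Matrix (Fin 2) (Fin 2) (QuatForm.Quat ℝ))ˣ)
        (hu : QuatForm.leftMulUnits ℝ u ∈ QuatForm.group.points ℝ),
        (e ⟨QuatForm.leftMulUnits ℝ u, hu⟩ : Matrix (Fin 4) (Fin 4) ℝ) =
          QuatForm.iota ℝ (√3 : ℝ) QuatForm.sqrt_three_sq u) ∧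
    AlgGroup.HasSplitRank ℚ QuatForm.group 1 ∧
    AlgGroup.HasSplitRank ℝ QuatForm.group 3 ∧
    AlgGroup.IsMaximalSplitTorus ℚ QuatForm.group QuatForm.torus ∧
    ∀ S : AlgGroup ℚ (Fin 2 × Fin 4), AlgGroup.IsMaximalSplitTorus ℚ QuatForm.group S →
      ∃ x : QuatForm.group.points ℝ ⧸ QuatForm.group.arith,
        IsCompact (QuatForm.group.torusOrbit S x) ∧
        ∀ K : Set (QuatForm.group.points ℝ ⧸ QuatForm.group.arith), IsCompact K →
          ∃ g : QuatForm.group.points ℝ, (g • QuatForm.group.torusOrbit S x) ∩ K = ∅ := by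
  refine ⟨QuatForm.isSemisimple_group,
    ⟨QuatForm.normOneContEquiv √3 QuatForm.sqrt_three_sq (1 / 6) (by norm_num), fun u hu => ?_⟩,
    QuatForm.hasSplitRank_rat, QuatForm.hasSplitRank_real, QuatForm.torus_isMaximalSplitTorus,
    fun S hS => ?_⟩
  · change QuatForm.iota ℝ √3 QuatForm.sqrt_three_sq
      (QuatForm.extract (QuatForm.leftMul ℝ u)) = _
    rw [QuatForm.extract_leftMul]
  · obtain ⟨h, hh⟩ := QuatForm.exists_conj_of_isMaximalSplitTorus hS
    -- At the base point hΓ the conjugation cancels: (hAh⁻¹)hΓ = hAΓ.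
    have horbit : QuatForm.group.torusOrbit S (QuotientGroup.mk h) =
        {y | ∃ s : ℝˣ, y = QuotientGroup.mk (h * QuatForm.hypTorus s)} := by
      ext y
      constructor
      · rintro ⟨g, hg, rfl⟩
        obtain ⟨s, rfl⟩ := (hh g).1 hg
        refine ⟨s, ?_⟩
        rw [MulAction.Quotient.smul_mk, smul_eq_mul, inv_mul_cancel_right]
      · rintro ⟨s, rfl⟩
        refine ⟨h * QuatForm.hypTorus s * h⁻¹, (hh _).2 ⟨s, rfl⟩, ?_⟩
        rw [MulAction.Quotient.smul_mk, smul_eq_mul, inv_mul_cancel_right]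
    refine ⟨QuotientGroup.mk h, ?_, fun K hK => ?_⟩
    · rw [horbit]
      exact QuatForm.isCompact_hypTorus_orbit h
    · obtain ⟨a, ha⟩ := QuatForm.exists_forall_notMem hK
      -- The factor h⁻¹ moves the orbit back to AΓ, and a pushes it off K.
      refine ⟨a * h⁻¹, ?_⟩
      rw [horbit, Set.eq_empty_iff_forall_notMem]
      rintro _ ⟨⟨_, ⟨s, rfl⟩, rfl⟩, hK'⟩
      apply ha s
      have : (a * h⁻¹) • (QuotientGroup.mk (h * QuatForm.hypTorus s) :
          QuatForm.group.points ℝ ⧸ QuatForm.group.arith) =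
          QuotientGroup.mk (a * QuatForm.hypTorus s) := by
        rw [MulAction.Quotient.smul_mk, smul_eq_mul, mul_assoc, inv_mul_cancel_left]
      rw [← this]
      exact hK'
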